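/- Let $(X,f)$ be a dynamical system, i.e. $X$ is a compact metric space and $f:X\to X$ is continuous, with finite topological entropy. Let $\mathcal M_f(X)$ be the set of $f$-invariant Borel probability measures with the weak$^*$ topology, $h_\mu(f)$ the metric (Kolmogorov–Sinai) entropy of $\mu\in\mathcal M_f(X)$, $h_{\mathrm{top}}(f,Y)$ the topological entropy, in the sense of Bowen, of an arbitrary subset $Y\subset X$, $h_{\mathrm{top}}(f)=h_{\mathrm{top}}(f,X)$, and $P_f(\varphi)$ the topological pressure of $\varphi\in C(X)$. Assume: (H1) the map $\mu\mapsto h_\mu(f)$ is upper semicontinuous on $\mathcal M_f(X)$; (H2) every Lipschitz function $\varphi:X\to\mathbb R$ has a unique equilibrium state, i.e. there is exactly one $\mu\in\mathcal M_f(X)$ with $P_f(\varphi)=h_\mu(f)+\int\varphi\,d\mu$; (H3) for every $\mu\in\mathcal M_f(X)$ the set $G_\mu=\{x\in X:\frac1n\sum_{k=0}^{n-1}\delta_{f^k(x)}\to\mu \text{ weak}^*\}$ is nonempty and $h_{\mathrm{top}}(f,G_\mu)=h_\mu(f)$. For $\varphi\in C(X)$ (real-valued, with the sup norm) and $\alpha\in\mathbb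 R$ put $$L(\varphi,\alpha)=\Big\{x\in X:\lim_{n\to\infty}\tfrac1n\sum_{k=0}^{n-1}\varphi(f^kx)=\alpha\Big\},\qquad R(\varphi)=\{\alpha\in\mathbb R: L(\varphi,\alpha)\ne\emptyset\},$$ let $E(\varphi)(\alpha)=h_{\mathrm{top}}(f,L(\varphi,\alpha))$ for $\alpha\in R(\varphi)$ be the multifractal entropy spectrum of $\varphi$, and let $\Gamma_{E(\varphi)}=\{(\alpha,E(\varphi)(\alpha)):\alpha\in R(\varphi)\}$ be its graph. Then for every $\varphi\in C(X)$ the function $E(\varphi)$ is finite-valued and its graph $\Gamma_{E(\varphi)}$ is a nonempty compact subset of $\mathbb R^2$. If moreover $h_{\mathrm{top}}(f)>0$, then for every $\varphi\in C(X)$ the function $E(\varphi)$ belongs to the class $C_{ms}$, that is, $R(\varphi)$ is a nonempty compact interval, $E(\varphi):R(\varphi)\to[0,\infty)$ is continuous and concave, and $E(\varphi)$ attains a strictly positive maximum at a unique point. Finally, the multifractal entropy spectrum map $\varphi\mapsto E(\varphi)$ is lower semicontinuous at every $\varphi\in C(X)$: for every sequence $\varphi_n\to\varphi$ in $C(X)$,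 $$\sup_{q\in\Gamma_{E(\varphi)}}\operatorname{dist}\big(q,\Gamma_{E(\varphi_n)}\big)\longrightarrow 0\qquad(n\to\infty),$$ where $\operatorname{dist}$ is the Euclidean distance in $\mathbb R^2$. -/

import Mathlib

open MeasureTheory Filter Topology Set
open scoped ENNReal NNReal

namespace MultifractalSpectrum

noncomputable section

/-! ### Metric entropy -/

/-- Shannon entropy `-∑ μ(A) log μ(A)` of the finite partition of `X` into the fibres of `ξ`. -/
def partitionEntropy {X ι : Type*} [MeasurableSpace X] [Fintype ι] (μ : Measure X)
    (ξ : X → ι) : ℝ :=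
  ∑ w : ι, Real.negMulLog (μ.real (ξ ⁻¹' {w}))

/-- The map whose fibres form the joined partition `ξ ∨ f⁻¹ ξ ∨ ⋯ ∨ f⁻⁽ⁿ⁻¹⁾ ξ`. -/
def itinerary {X ι : Type*} (f : X → X) (ξ : X → ι) (n : ℕ) : X → (Fin n → ι) :=
  fun x i => ξ (f^[(i : ℕ)] x)

/-- Kolmogorov–Sinai entropy `h_μ(f)`: supremum over all finite measurable partitions `ξ` of
the limit of `H_μ(ξ ∨ ⋯ ∨ f⁻⁽ⁿ⁻¹⁾ ξ) / n` (the limit exists when `μ` is invariant). -/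
def metricEntropy {X : Type*} [MeasurableSpace X] (f : X → X) (μ : Measure X) : ℝ≥0∞ :=
  ⨆ (k : ℕ) (ξ : X → Fin k) (_ : Measurable ξ),
    limsup (fun n : ℕ => ENNReal.ofReal (partitionEntropy μ (itinerary f ξ n) / n)) atTop

/-! ### Bowen's topological entropy of an arbitrary subset -/

/-- `D_𝒜(E) = exp (-n)`, with `n ∈ ℕ ∪ {∞}` the largest number such that each of
`E, f E, …, fⁿ⁻¹ E` lies in a member of `𝒜` (so `D_𝒜(E) = 0` if `n = ∞`). -/
def bowenSize {X : Type*} (f : X → X) (𝒜 : Set (Set X)) (E : Set X) : ℝ≥0∞ :=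
  ⨅ (n : ℕ) (_ : ∀ k < n, ∃ U ∈ 𝒜, f^[k] '' E ⊆ U), ENNReal.ofReal (Real.exp (-(n : ℝ)))

/-- `m_{𝒜,s}(Y) = lim_{ε → 0} inf ∑ D_𝒜(E_i)^s`, the infimum being over the countable covers
`(E_i)` of `Y` with `D_𝒜(E_i) < ε` for all `i`. -/
def bowenMeasure {X : Type*} (f : X → X) (𝒜 : Set (Set X)) (s : ℝ) (Y : Set X) : ℝ≥0∞ :=
  ⨆ (ε : ℝ≥0∞) (_ : 0 < ε),
    ⨅ (E : ℕ → Set X) (_ : Y ⊆ ⋃ i, E i) (_ : ∀ i, bowenSize f 𝒜 (E i) < ε),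
      ∑' i, bowenSize f 𝒜 (E i) ^ s

/-- `h_𝒜(f, Y) = inf {s > 0 : m_{𝒜,s}(Y) = 0}`. -/
def coverEntropy {X : Type*} (f : X → X) (𝒜 : Set (Set X)) (Y : Set X) : ℝ≥0∞ :=
  ⨅ (s : ℝ≥0) (_ : 0 < s) (_ : bowenMeasure f 𝒜 s Y = 0), (s : ℝ≥0∞)

/-- Bowen's topological entropy `h_top(f, Y)` of a (not necessarily compact or invariant) subset
`Y`: supremum of `h_𝒜(f, Y)` over the finite open covers `𝒜` of the space. -/
def topEntropy {X : Type*} [TopologicalSpace X] (f : X → X) (Y : Set X) : ℝ≥0∞ :=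
  ⨆ (𝒜 : Set (Set X)) (_ : 𝒜.Finite) (_ : ∀ U ∈ 𝒜, IsOpen U) (_ : ⋃₀ 𝒜 = univ),
    coverEntropy f 𝒜 Y

/-! ### Topological pressure -/

/-- `E` is `(n, ε)`-separated. -/
def IsSeparatedSet {X : Type*} [MetricSpace X] (f : X → X) (n : ℕ) (ε : ℝ) (E : Finset X) :
    Prop :=
  ∀ x ∈ E, ∀ y ∈ E, x ≠ y → ∃ k < n, ε < dist (f^[k] x) (f^[k] y)

/-- `sup ∑_{x ∈ E} exp (S_n φ (x))` over the `(n, ε)`-separated sets `E`. -/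
def partitionFunction {X : Type*} [MetricSpace X] (f : X → X) (φ : X → ℝ) (n : ℕ) (ε : ℝ) :
    ℝ≥0∞ :=
  ⨆ (E : Finset X) (_ : IsSeparatedSet f n ε E),
    ∑ x ∈ E, ENNReal.ofReal (Real.exp (birkhoffSum f φ n x))

/-- Topological pressure `P_f(φ) = lim_{ε → 0} limsup_n (1/n) log sup_E ∑_{x ∈ E} exp (S_n φ(x))`
(the limit is a supremum, by monotonicity in `ε`). -/
def pressure {X : Type*} [MetricSpace X] (f : X → X) (φ : X → ℝ) : EReal :=
  ⨆ (ε : ℝ) (_ : 0 < ε),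
    limsup (fun n : ℕ => ENNReal.log (partitionFunction f φ n ε) / (n : EReal)) atTop

/-! ### Invariant measures and the standing hypotheses -/

section Systems

variable {X : Type*} [MetricSpace X] [CompactSpace X] [MeasurableSpace X] [BorelSpace X]

/-- `ℳ_f(X)`: the `f`-invariant Borel probability measures, inside the space of all Borel
probability measures with the weak-* topology. -/
def invariantMeasures (f : C(X, X)) : Set (ProbabilityMeasure X) :=
  {μ | MeasurePreserving f (μ : Measure X) (μ : Measure X)}

/-- `μ` is an equilibrium state of `φ`: it is invariant and `P_f(φ) = h_μ(f) + ∫ φ dμ`. -/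
def IsEquilibriumState (f : C(X, X)) (φ : C(X, ℝ)) (μ : ProbabilityMeasure X) : Prop :=
  μ ∈ invariantMeasures f ∧
    pressure f φ = (metricEntropy f (μ : Measure X) : EReal) +
      ((∫ x, φ x ∂(μ : Measure X) : ℝ) : EReal)

/-- The empirical measure `(1/N) ∑_{k < N} δ_{f^k x}` with `N = n + 1`. -/
def empiricalMeasure (f : C(X, X)) (x : X) (n : ℕ) : ProbabilityMeasure X :=
  ⟨((n + 1 : ℕ) : ℝ≥0∞)⁻¹ • ∑ k ∈ Finset.range (n + 1), Measure.dirac (f^[k] x), by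
    constructor
    rw [Measure.smul_apply, Measure.finsetSum_apply]
    simp only [measure_univ, Finset.sum_const, Finset.card_range, nsmul_eq_mul, mul_one,
      smul_eq_mul]
    exact ENNReal.inv_mul_cancel (by exact_mod_cast Nat.succ_ne_zero n)
      (ENNReal.natCast_ne_top _)⟩

/-- The generic set `G_μ`. -/
def genericSet (f : C(X, X)) (μ : ProbabilityMeasure X) : Set X :=
  {x | Tendsto (empiricalMeasure f x) atTop (𝓝 μ)}

/-- The entropy map `μ ↦ h_μ(f)` is upper semicontinuous on `ℳ_f(X)`. -/
def EntropyUpperSemicontinuous (f : C(X, X)) : Prop :=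
  UpperSemicontinuousOn (fun μ : ProbabilityMeasure X => metricEntropy f (μ : Measure X))
    (invariantMeasures f)

/-- Every Lipschitz potential has a unique equilibrium state. -/
def LipschitzUniqueEquilibrium (f : C(X, X)) : Prop :=
  ∀ φ : C(X, ℝ), (∃ K : ℝ≥0, LipschitzWith K φ) →
    ∃! μ : ProbabilityMeasure X, IsEquilibriumState f φ μ

/-- The saturated property for every invariant measure: `G_μ ≠ ∅` and
`h_top(f, G_μ) = h_μ(f)`. -/
def SaturatedProperty (f : C(X, X)) : Prop :=
  ∀ μ ∈ invariantMeasures f,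
    (genericSet f μ).Nonempty ∧ topEntropy f (genericSet f μ) = metricEntropy f (μ : Measure X)

end Systems

/-! ### The multifractal entropy spectrum -/

section Spectrum

variable {X : Type*} [MetricSpace X] [CompactSpace X]

/-- The Birkhoff level set `L(φ, α; X, f)`. -/
def levelSet (f : C(X, X)) (φ : C(X, ℝ)) (α : ℝ) : Set X :=
  {x | Tendsto (fun n : ℕ => birkhoffAverage ℝ f φ n x) atTop (𝓝 α)}

/-- The rotation set `R(φ; X, f)`. -/
def rotationSet (f : C(X, X)) (φ : C(X, ℝ)) : Set ℝ :=
  {α | (levelSet f φ α).Nonempty}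

/-- The multifractal entropy spectrum `E(φ)(α) = h_top(f, L(φ, α; X, f))`, as a real number
(meaningful for `α ∈ R(φ; X, f)` when the entropy is finite). -/
def entropySpectrum (f : C(X, X)) (φ : C(X, ℝ)) (α : ℝ) : ℝ :=
  (topEntropy f (levelSet f φ α)).toReal

end Spectrum

/-- `h : I → [0, ∞)` belongs to `C_ms`: `I` is a nonempty compact interval, `h` is continuous
and concave on `I`, and it attains a strictly positive maximum at a unique point of `I`. -/
structure MemCms (I : Set ℝ) (h : ℝ → ℝ) : Prop where
  interval : ∃ a b : ℝ, a ≤ b ∧ I = Icc a b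
  nonneg : ∀ α ∈ I, 0 ≤ h α
  continuousOn : ContinuousOn h I
  concaveOn : ConcaveOn ℝ I h
  unique_max : ∃ α ∈ I, 0 < h α ∧ ∀ β ∈ I, β ≠ α → h β < h α

/-- The graph of `h : I → ℝ` in the Euclidean plane. -/
def spectrumGraph (I : Set ℝ) (h : ℝ → ℝ) : Set (EuclideanSpace ℝ (Fin 2)) :=
  (fun α => !₂[α, h α]) '' I

/-- The one-sided Hausdorff excess `e(A, B) = sup_{a ∈ A} dist(a, B)`. -/
def excess {P : Type*} [PseudoEMetricSpace P] (A B : Set P) : ℝ≥0∞ :=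
  ⨆ a ∈ A, Metric.infEDist a B

/-- Lower semicontinuity of a set-valued map at a point:
`e(Φ(φ), Φ(φ_n)) → 0` for every sequence `φ_n → φ`. -/
def LowerSemicontinuousSetMapAt {C P : Type*} [TopologicalSpace C] [PseudoEMetricSpace P]
    (Φ : C → Set P) (φ : C) : Prop :=
  ∀ u : ℕ → C, Tendsto u atTop (𝓝 φ) →
    Tendsto (fun n => excess (Φ φ) (Φ (u n))) atTop (𝓝 0)

end

end MultifractalSpectrum

open MultifractalSpectrum

/-!
The spectrum obeys a conditional variational principle: `h_top(f, L(φ, α))` is the largest entropy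
of an invariant measure `μ` with `∫ φ dμ = α`, and `R(φ)` is the set of all such integrals. The
rest follows from soft properties of the entropy on the compact convex set of invariant measures.

*Variational principle* (`exists_entropySpectrum_eq_metricEntropy`). The generic set of `μ` lies in
the level set of `∫ φ dμ`, so saturation gives one inequality. For the other, a covering by Bowen
balls around maximal separated sets shows `h_top(f, Y) ≤ P_f(χ) - a` whenever the Birkhoff averages
of `χ` are eventually at least `a` on `Y` (`topEntropy_le_of_pressure_lt`). With `χ` a Lipschitz
function close to `q φ`, the existence of an equilibrium state bounds `P_f(χ)` by the supremum of
`h_μ(f) + ∫ χ dμ`, so that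
`h_top(f, L(φ, α)) ≤ sup_μ (h_μ(f) + q ∫ φ dμ) - q α` for every real `q`
(`topEntropy_levelSet_le`). The set of pairs `(∫ φ dμ, t)` with `t ≤ h_μ(f)` is convex, as entropy
is concave (`metricEntropy_concave`), and closed, as entropy is upper semicontinuous. Separating a
point above it by a line produces a slope `q` for which the bound is as close as desired to the
largest entropy on the fibre over `α` (`exists_supporting_slope`). Neither half of the variational
principle for the pressure of general potentials is needed.

*Shape of the spectrum.* The spectrum is concave and has a closed hypograph; a nonnegative concave
function on a compact interval is lower semicontinuous up to the endpoints, whence continuity. The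
maximum is `h_top(f)`, attained over the integral of the equilibrium state of the zero potential,
and uniqueness of that state makes the maximizing level unique.

*Lower semicontinuity of the spectrum map.* If `μ` realizes `E(φ)(α)`, then at the levels
`∫ φₙ dμ → α` the spectra of `φₙ → φ` are at least `h_μ(f)`, and by upper semicontinuity of the
entropy they are not larger in the limit. This is pointwise convergence of graph points, which is
uniform because the graph of `E(φ)` is compact.
-/

namespace MultifractalSpectrum

/-! ### Entropy of partitions -/

lemma negMulLog_sum_le {ι : Type*} (s : Finset ι) (p : ι → ℝ) (hp : ∀ i ∈ s, 0 ≤ p i) :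
    Real.negMulLog (∑ i ∈ s, p i) ≤ ∑ i ∈ s, Real.negMulLog (p i) := by
  rw [Real.negMulLog_def]
  simp only [neg_mul, Finset.sum_mul, ← Finset.sum_neg_distrib]
  refine Finset.sum_le_sum fun i hi => neg_le_neg ?_
  rcases (hp i hi).eq_or_lt with h0 | h0
  · simp [← h0]
  · exact mul_le_mul_of_nonneg_left
      (Real.log_le_log h0 (Finset.single_le_sum hp hi)) (hp i hi)

/-- Subadditivity of Shannon entropy for a joint distribution `p` with marginals given by the row
and column sums. -/
lemma sum_negMulLog_le_marginals {ι κ : Type*} [Fintype ι] [Fintype κ] (p : ι → κ → ℝ)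
    (hp : ∀ i j, 0 ≤ p i j) (h1 : ∑ i, ∑ j, p i j = 1) :
    ∑ i, ∑ j, Real.negMulLog (p i j) ≤
      ∑ i, Real.negMulLog (∑ j, p i j) + ∑ j, Real.negMulLog (∑ i, p i j) := by
  set a : ι → ℝ := fun i => ∑ j, p i j with ha
  set b : κ → ℝ := fun j => ∑ i, p i j with hb
  -- Gibbs' inequality, from `log x ≤ x - 1` with `x = a i * b j / p i j`
  have key : ∀ i j, Real.negMulLog (p i j) ≤
      -(p i j * Real.log (a i)) - p i j * Real.log (b j) + (a i * b j - p i j) := by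
    intro i j
    have hai : p i j ≤ a i := Finset.single_le_sum (fun j _ => hp i j) (Finset.mem_univ j)
    have hbj : p i j ≤ b j :=
      Finset.single_le_sum (f := fun i => p i j) (fun i _ => hp i j) (Finset.mem_univ i)
    rcases (hp i j).eq_or_lt with h0 | h0
    · rw [← h0] at hai hbj ⊢
      simpa using mul_nonneg hai hbj
    · have ha0 := h0.trans_le hai
      have hb0 := h0.trans_le hbj
      have := Real.log_le_sub_one_of_pos (div_pos (mul_pos ha0 hb0) h0)
      rw [Real.log_div (mul_pos ha0 hb0).ne' h0.ne', Real.log_mul ha0.ne' hb0.ne'] at this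
      have h2 := mul_le_mul_of_nonneg_left this h0.le
      have h3 : p i j * (a i * b j / p i j - 1) = a i * b j - p i j := by field_simp
      rw [h3] at h2
      simp only [Real.negMulLog]
      nlinarith
  have hb1 : ∑ j, b j = 1 := by rw [hb, Finset.sum_comm]; exact h1
  have ha1 : ∑ i, a i = 1 := h1
  calc ∑ i, ∑ j, Real.negMulLog (p i j)
      ≤ ∑ i, ∑ j, (-(p i j * Real.log (a i)) - p i j * Real.log (b j) + (a i * b j - p i j)) :=
        Finset.sum_le_sum fun i _ => Finset.sum_le_sum fun j _ => key i j
    _ = (∑ i, ∑ j, -(p i j * Real.log (a i))) - (∑ i, ∑ j, p i j * Real.log (b j)) +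
          (∑ i, ∑ j, a i * b j - ∑ i, ∑ j, p i j) := by
        simp only [Finset.sum_add_distrib, Finset.sum_sub_distrib]
    _ = _ := by
        have e1 : ∑ i, ∑ j, a i * b j = 1 := by
          simp_rw [← Finset.mul_sum, hb1, mul_one]; exact ha1
        have e2 : ∑ i, ∑ j, p i j * Real.log (b j) = ∑ j, b j * Real.log (b j) := by
          rw [Finset.sum_comm]; simp_rw [← Finset.sum_mul]; rfl
        have e3 : ∑ i, ∑ j, -(p i j * Real.log (a i)) = -∑ i, a i * Real.log (a i) := by
          simp_rw [Finset.sum_neg_distrib, ← Finset.sum_mul]; rfl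
        rw [e1, e2, e3, h1]
        simp only [Real.negMulLog, neg_mul, Finset.sum_neg_distrib]
        ring

section Partition

variable {X : Type*} [MeasurableSpace X] {ι κ : Type*}

lemma partitionEntropy_nonneg [Fintype ι]
    (μ : Measure X) [IsProbabilityMeasure μ] (ξ : X → ι) :
    0 ≤ partitionEntropy μ ξ :=
  Finset.sum_nonneg fun _ _ => Real.negMulLog_nonneg measureReal_nonneg measureReal_le_one

lemma measureReal_comp_fiber [Fintype κ] [MeasurableSpace κ] [MeasurableSingletonClass κ]
    (μ : Measure X) [IsFiniteMeasure μ] {ζ : X → κ} (hζ : Measurable ζ)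
    (π : κ → ι) [DecidableEq ι] (w : ι) :
    μ.real ((π ∘ ζ) ⁻¹' {w}) = ∑ v with π v = w, μ.real (ζ ⁻¹' {v}) := by
  rw [← measureReal_biUnion_finset]
  · congr 1
    ext x
    simp
  · intro u _ v _ huv
    exact Disjoint.preimage _ (by simpa using huv)
  · exact fun v _ => hζ (measurableSet_singleton v)

/-- A coarser partition has smaller entropy. -/
lemma partitionEntropy_comp_le [Fintype ι] [Fintype κ] [MeasurableSpace κ]
    [MeasurableSingletonClass κ] (μ : Measure X) [IsFiniteMeasure μ] {ζ : X → κ}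
    (hζ : Measurable ζ) (π : κ → ι) :
    partitionEntropy μ (π ∘ ζ) ≤ partitionEntropy μ ζ := by
  classical
  unfold partitionEntropy
  rw [← Finset.sum_fiberwise Finset.univ π]
  refine Finset.sum_le_sum fun w _ => ?_
  rw [measureReal_comp_fiber μ hζ π w]
  exact negMulLog_sum_le _ _ fun _ _ => measureReal_nonneg

/-- The entropy of the join of two partitions is at most the sum of their entropies. -/
lemma partitionEntropy_prod_le [Fintype ι] [MeasurableSpace ι] [MeasurableSingletonClass ι]
    [Fintype κ] [MeasurableSpace κ] [MeasurableSingletonClass κ]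
    (μ : Measure X) [IsProbabilityMeasure μ] {ξ : X → ι} {η : X → κ}
    (hξ : Measurable ξ) (hη : Measurable η) :
    partitionEntropy μ (fun x => (ξ x, η x)) ≤ partitionEntropy μ ξ + partitionEntropy μ η := by
  classical
  have hm : Measurable fun x => (ξ x, η x) := hξ.prodMk hη
  have hrow : ∀ i, ∑ j, μ.real ((fun x => (ξ x, η x)) ⁻¹' {(i, j)}) = μ.real (ξ ⁻¹' {i}) := by
    intro i
    have := measureReal_comp_fiber μ hm Prod.fst i
    rw [show Prod.fst ∘ (fun x => (ξ x, η x)) = ξ from rfl, Finset.sum_filter,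
      Fintype.sum_prod_type_right] at this
    simpa using this.symm
  have hcol : ∀ j, ∑ i, μ.real ((fun x => (ξ x, η x)) ⁻¹' {(i, j)}) = μ.real (η ⁻¹' {j}) := by
    intro j
    have := measureReal_comp_fiber μ hm Prod.snd j
    rw [show Prod.snd ∘ (fun x => (ξ x, η x)) = η from rfl, Finset.sum_filter,
      Fintype.sum_prod_type] at this
    simpa using this.symm
  have htot : ∑ i, μ.real (ξ ⁻¹' {i}) = 1 := by
    have := measureReal_comp_fiber μ hξ (fun _ => ()) ()
    simpa [Set.preimage, Function.comp_def] using this.symm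
  have := sum_negMulLog_le_marginals
    (fun i j => μ.real ((fun x => (ξ x, η x)) ⁻¹' {(i, j)})) (fun _ _ => measureReal_nonneg)
    (by simp_rw [hrow]; exact htot)
  simp_rw [hrow, hcol] at this
  unfold partitionEntropy
  rwa [Fintype.sum_prod_type]

lemma partitionEntropy_comp_iterate [Fintype ι] [MeasurableSpace ι] [MeasurableSingletonClass ι]
    {f : X → X} {μ : Measure X} (hf : MeasurePreserving f μ μ)
    {ξ : X → ι} (hξ : Measurable ξ) (m : ℕ) :
    partitionEntropy μ (fun x => ξ (f^[m] x)) = partitionEntropy μ ξ := by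
  unfold partitionEntropy
  refine Finset.sum_congr rfl fun w _ => ?_
  congr 1
  exact (hf.iterate m).measureReal_preimage (hξ (measurableSet_singleton w)).nullMeasurableSet

lemma measurable_itinerary [MeasurableSpace ι]
    {f : X → X} (hf : Measurable f) {ξ : X → ι} (hξ : Measurable ξ)
    (n : ℕ) : Measurable (itinerary f ξ n) :=
  measurable_pi_lambda _ fun i => hξ.comp (hf.iterate i)

/-- `H_μ(ξ ∨ ⋯ ∨ f⁻⁽ⁿ⁻¹⁾ ξ)` is subadditive in `n` for an invariant measure. -/
lemma subadditive_partitionEntropy_itinerary [Fintype ι] [MeasurableSpace ι]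
    [MeasurableSingletonClass ι] {f : X → X} {μ : Measure X} [IsProbabilityMeasure μ]
    (hf : MeasurePreserving f μ μ) {ξ : X → ι} (hξ : Measurable ξ) :
    Subadditive fun n => partitionEntropy μ (itinerary f ξ n) := by
  intro m n
  have hm := measurable_itinerary hf.measurable hξ m
  have hn := measurable_itinerary hf.measurable hξ n
  have hn' : Measurable fun x => itinerary f ξ n (f^[m] x) := hn.comp (hf.measurable.iterate m)
  have e : itinerary f ξ (m + n) =
      (fun w : (Fin m → ι) × (Fin n → ι) => Fin.append w.1 w.2) ∘
        fun x => (itinerary f ξ m x, itinerary f ξ n (f^[m] x)) := by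
    funext x i
    refine Fin.addCases (fun i => ?_) (fun i => ?_) i
    · simp [itinerary]
    · simp [itinerary, ← Function.iterate_add_apply, add_comm]
  calc partitionEntropy μ (itinerary f ξ (m + n))
      ≤ partitionEntropy μ fun x => (itinerary f ξ m x, itinerary f ξ n (f^[m] x)) := by
        rw [e]; exact partitionEntropy_comp_le μ (hm.prodMk hn') _
    _ ≤ _ := partitionEntropy_prod_le μ hm hn'
    _ = _ := by rw [partitionEntropy_comp_iterate hf hn]

/-- The entropy rate of a partition is a genuine limit for an invariant measure. -/
lemma exists_tendsto_partitionEntropy [Fintype ι] [MeasurableSpace ι] [MeasurableSingletonClass ι]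
    {f : X → X} {μ : Measure X} [IsProbabilityMeasure μ]
    (hf : MeasurePreserving f μ μ) {ξ : X → ι} (hξ : Measurable ξ) :
    ∃ l : ℝ, Tendsto (fun n : ℕ => partitionEntropy μ (itinerary f ξ n) / n) atTop (𝓝 l) :=
  ⟨_, (subadditive_partitionEntropy_itinerary hf hξ).tendsto_lim
    ⟨0, by
      rintro _ ⟨n, rfl⟩
      exact div_nonneg (partitionEntropy_nonneg μ _) n.cast_nonneg⟩⟩

lemma partitionEntropy_concave [Fintype ι]
    (μ ν ρ : Measure X) (ξ : X → ι)
    {s t : ℝ} (hs : 0 ≤ s) (ht : 0 ≤ t) (hst : s + t = 1)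
    (hρ : ∀ A, ρ.real A = s * μ.real A + t * ν.real A) :
    s * partitionEntropy μ ξ + t * partitionEntropy ν ξ ≤ partitionEntropy ρ ξ := by
  unfold partitionEntropy
  rw [Finset.mul_sum, Finset.mul_sum, ← Finset.sum_add_distrib]
  refine Finset.sum_le_sum fun w _ => ?_
  rw [hρ]
  exact Real.concaveOn_negMulLog.2 (mem_Ici.2 measureReal_nonneg) (mem_Ici.2 measureReal_nonneg)
    hs ht hst

end Partition

/-! ### Concavity of the metric entropy -/

section Concave

variable {X : Type*} [MeasurableSpace X]

/-- The entropy of `μ` with respect to a fixed partition. -/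
noncomputable def entropyRate {ι : Type*} [Fintype ι] (f : X → X) (μ : Measure X) (ξ : X → ι) :
    ℝ≥0∞ :=
  limsup (fun n : ℕ => ENNReal.ofReal (partitionEntropy μ (itinerary f ξ n) / n)) atTop

lemma metricEntropy_eq_iSup_entropyRate (f : X → X) (μ : Measure X) :
    metricEntropy f μ =
      ⨆ ξ : Σ k : ℕ, {ξ : X → Fin k // Measurable ξ}, entropyRate f μ ξ.2.1 := by
  rw [iSup_sigma]
  simp_rw [iSup_subtype]
  rfl

/-- Bounding by the entropy of the join is what makes entropy concave: both measures can be tested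
on one partition. -/
lemma add_entropyRate_le_metricEntropy {f : X → X} {μ ν ρ : Measure X} [IsProbabilityMeasure μ]
    [IsProbabilityMeasure ν] [IsProbabilityMeasure ρ] (hμ : MeasurePreserving f μ μ)
    (hν : MeasurePreserving f ν ν) (hρ : MeasurePreserving f ρ ρ)
    {s t : ℝ} (hs : 0 ≤ s) (ht : 0 ≤ t) (hst : s + t = 1)
    (h : ∀ A, ρ.real A = s * μ.real A + t * ν.real A)
    {k l : ℕ} {ξ : X → Fin k} {η : X → Fin l} (hξ : Measurable ξ) (hη : Measurable η) :
    ENNReal.ofReal s * entropyRate f μ ξ + ENNReal.ofReal t * entropyRate f ν η ≤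
      metricEntropy f ρ := by
  set ζ : X → Fin (k * l) := fun x => finProdFinEquiv (ξ x, η x) with hζd
  have hζ : Measurable ζ :=
    (measurable_of_finite (finProdFinEquiv : Fin k × Fin l → _)).comp (hξ.prodMk hη)
  have e1 : ∀ n, itinerary f ξ n =
      (fun w : Fin n → Fin (k * l) => fun i => (finProdFinEquiv.symm (w i)).1) ∘
        itinerary f ζ n := by
    intro n; funext x i; simp [itinerary, hζd, -finProdFinEquiv_symm_apply]
  have e2 : ∀ n, itinerary f η n =
      (fun w : Fin n → Fin (k * l) => fun i => (finProdFinEquiv.symm (w i)).2) ∘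
        itinerary f ζ n := by
    intro n; funext x i; simp [itinerary, hζd, -finProdFinEquiv_symm_apply]
  obtain ⟨a, ha⟩ := exists_tendsto_partitionEntropy hμ hξ
  obtain ⟨b, hb⟩ := exists_tendsto_partitionEntropy hν hη
  obtain ⟨c, hc⟩ := exists_tendsto_partitionEntropy hρ hζ
  have rate : ∀ {u : ℕ → ℝ} {x : ℝ}, Tendsto u atTop (𝓝 x) →
      limsup (fun n => ENNReal.ofReal (u n)) atTop = ENNReal.ofReal x := fun hu =>
    (ENNReal.tendsto_ofReal hu).limsup_eq
  have ha0 : 0 ≤ a := ge_of_tendsto' ha fun n =>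
    div_nonneg (partitionEntropy_nonneg μ _) n.cast_nonneg
  have hb0 : 0 ≤ b := ge_of_tendsto' hb fun n =>
    div_nonneg (partitionEntropy_nonneg ν _) n.cast_nonneg
  have hle : s * a + t * b ≤ c := by
    refine le_of_tendsto_of_tendsto' ((ha.const_mul s).add (hb.const_mul t)) hc fun n => ?_
    have hm := measurable_itinerary hμ.measurable hζ n
    have h1 : partitionEntropy μ (itinerary f ξ n) ≤ partitionEntropy μ (itinerary f ζ n) := by
      rw [e1]; exact partitionEntropy_comp_le μ hm _
    have h2 : partitionEntropy ν (itinerary f η n) ≤ partitionEntropy ν (itinerary f ζ n) := by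
      rw [e2]; exact partitionEntropy_comp_le ν hm _
    have h3 := partitionEntropy_concave μ ν ρ (itinerary f ζ n) hs ht hst h
    rw [mul_div_assoc', mul_div_assoc', ← add_div]
    refine div_le_div_of_nonneg_right (le_trans ?_ h3) n.cast_nonneg
    gcongr
  rw [entropyRate, entropyRate, rate ha, rate hb, ← ENNReal.ofReal_mul hs, ← ENNReal.ofReal_mul ht,
    ← ENNReal.ofReal_add (mul_nonneg hs ha0) (mul_nonneg ht hb0)]
  refine (ENNReal.ofReal_le_ofReal hle).trans ?_
  rw [metricEntropy_eq_iSup_entropyRate, ← rate hc]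
  exact le_iSup (fun ξ : Σ k : ℕ, {ξ : X → Fin k // Measurable ξ} => entropyRate f ρ ξ.2.1)
    ⟨k * l, ζ, hζ⟩

/-- Kolmogorov–Sinai entropy is concave on invariant measures. -/
lemma metricEntropy_concave {f : X → X} {μ ν ρ : Measure X} [IsProbabilityMeasure μ]
    [IsProbabilityMeasure ν] [IsProbabilityMeasure ρ] (hμ : MeasurePreserving f μ μ)
    (hν : MeasurePreserving f ν ν) (hρ : MeasurePreserving f ρ ρ)
    {s t : ℝ} (hs : 0 ≤ s) (ht : 0 ≤ t) (hst : s + t = 1)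
    (h : ∀ A, ρ.real A = s * μ.real A + t * ν.real A) :
    ENNReal.ofReal s * metricEntropy f μ + ENNReal.ofReal t * metricEntropy f ν ≤
      metricEntropy f ρ := by
  have : Nonempty (Σ k : ℕ, {ξ : X → Fin k // Measurable ξ}) :=
    ⟨⟨1, fun _ => 0, measurable_const⟩⟩
  rw [metricEntropy_eq_iSup_entropyRate f μ, metricEntropy_eq_iSup_entropyRate f ν,
    ENNReal.mul_iSup, ENNReal.mul_iSup]
  exact ENNReal.iSup_add_iSup_le fun ξ η =>
    add_entropyRate_le_metricEntropy hμ hν hρ hs ht hst h ξ.2.2 η.2.2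

end Concave

/-! ### Null sets of Bowen's outer measures -/

section Bowen

variable {X : Type*} {f : X → X} {𝒜 : Set (Set X)}

lemma bowenSize_le {E : Set X} {n : ℕ} (h : ∀ k < n, ∃ U ∈ 𝒜, f^[k] '' E ⊆ U) :
    bowenSize f 𝒜 E ≤ ENNReal.ofReal (Real.exp (-(n : ℝ))) :=
  iInf₂_le n h

lemma tendsto_ofReal_exp_neg_nat :
    Tendsto (fun n : ℕ => ENNReal.ofReal (Real.exp (-(n : ℝ)))) atTop (𝓝 0) := by
  have := ENNReal.tendsto_ofReal
    (Real.tendsto_exp_neg_atTop_nhds_zero.comp (tendsto_natCast_atTop_atTop (R := ℝ)))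
  simpa [Function.comp_def] using this

lemma bowenSize_empty (h𝒜 : 𝒜.Nonempty) : bowenSize f 𝒜 ∅ = 0 := by
  obtain ⟨U, hU⟩ := h𝒜
  refine le_antisymm (ge_of_tendsto' tendsto_ofReal_exp_neg_nat fun n => ?_) zero_le
  exact bowenSize_le fun k _ => ⟨U, hU, by simp⟩

lemma bowenMeasure_eq_zero_iff {s : ℝ} {Y : Set X} :
    bowenMeasure f 𝒜 s Y = 0 ↔ ∀ ε : ℝ≥0∞, 0 < ε → ∀ δ : ℝ≥0∞, 0 < δ →
      ∃ E : ℕ → Set X, Y ⊆ ⋃ i, E i ∧ (∀ i, bowenSize f 𝒜 (E i) < ε) ∧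
        ∑' i, bowenSize f 𝒜 (E i) ^ s < δ := by
  unfold bowenMeasure
  simp only [ENNReal.iSup_eq_zero]
  refine forall₂_congr fun ε _ => ?_
  rw [← bot_eq_zero, iInf_eq_bot]
  simp only [iInf_lt_iff, exists_prop, bot_eq_zero]

/-- A countable union of null sets is null. -/
lemma bowenMeasure_iUnion_eq_zero {s : ℝ} {Y : ℕ → Set X}
    (h : ∀ N, bowenMeasure f 𝒜 s (Y N) = 0) : bowenMeasure f 𝒜 s (⋃ N, Y N) = 0 := by
  rw [bowenMeasure_eq_zero_iff]
  intro ε hε δ hδ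
  obtain ⟨δ', hδ', hsum⟩ := ENNReal.exists_pos_sum_of_countable hδ.ne' ℕ
  choose E hE1 hE2 hE3 using fun N =>
    bowenMeasure_eq_zero_iff.1 (h N) ε hε (δ' N) (by exact_mod_cast hδ' N)
  refine ⟨fun i => E (Nat.unpair i).1 (Nat.unpair i).2, ?_, fun i => hE2 _ _, ?_⟩
  · refine iUnion_subset fun N x hx => ?_
    obtain ⟨i, hi⟩ := mem_iUnion.1 (hE1 N hx)
    exact mem_iUnion.2 ⟨Nat.pair N i, by simpa using hi⟩
  · calc ∑' i, bowenSize f 𝒜 (E (Nat.unpair i).1 (Nat.unpair i).2) ^ s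
        = ∑' p : ℕ × ℕ, bowenSize f 𝒜 (E p.1 p.2) ^ s :=
          Nat.pairEquiv.symm.tsum_eq (fun p : ℕ × ℕ => bowenSize f 𝒜 (E p.1 p.2) ^ s)
      _ = ∑' N, ∑' i, bowenSize f 𝒜 (E N i) ^ s :=
          ENNReal.tsum_prod (f := fun N i => bowenSize f 𝒜 (E N i) ^ s)
      _ ≤ ∑' N, (δ' N : ℝ≥0∞) := ENNReal.tsum_le_tsum fun N => (hE3 N).le
      _ < δ := hsum

/-- Finite covers at arbitrarily large times suffice to show that a set is null. -/
lemma bowenMeasure_eq_zero_of_finite_covers (h𝒜 : 𝒜.Nonempty) {s : ℝ} (hs : 0 < s) {Y : Set X}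
    (h : ∀ δ : ℝ, 0 < δ → ∀ᶠ n : ℕ in atTop, ∃ (T : Finset X) (B : X → Set X),
      Y ⊆ ⋃ x ∈ T, B x ∧ (∀ x ∈ T, ∀ k < n, ∃ U ∈ 𝒜, f^[k] '' B x ⊆ U) ∧
        T.card * Real.exp (-(n * s)) < δ) :
    bowenMeasure f 𝒜 s Y = 0 := by
  classical
  rw [bowenMeasure_eq_zero_iff]
  intro ε hε δ hδ
  obtain ⟨r, hr0, hrδ⟩ := ENNReal.lt_iff_exists_nnreal_btwn.1 hδ
  have hr : (0 : ℝ) < r := by exact_mod_cast hr0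
  obtain ⟨n, ⟨T, B, hcov, hB, hcard⟩, hn⟩ :=
    ((h r hr).and (tendsto_ofReal_exp_neg_nat.eventually_lt_const hε)).exists
  set E : ℕ → Set X := fun i =>
    if hi : i < T.card then B (T.equivFin.symm ⟨i, hi⟩) else ∅ with hE
  have hsize : ∀ i, bowenSize f 𝒜 (E i) ≤ ENNReal.ofReal (Real.exp (-(n : ℝ))) := by
    intro i
    by_cases hi : i < T.card
    · simp only [hE, hi, dif_pos]
      exact bowenSize_le (hB _ (T.equivFin.symm ⟨i, hi⟩).2)
    · simp only [hE, hi, dif_neg, not_false_eq_true, bowenSize_empty h𝒜, zero_le]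
  refine ⟨E, fun y hy => ?_, fun i => (hsize i).trans_lt hn, ?_⟩
  · obtain ⟨x, hx, hyx⟩ := mem_iUnion₂.1 (hcov hy)
    refine mem_iUnion.2 ⟨T.equivFin ⟨x, hx⟩, ?_⟩
    simpa [hE] using hyx
  · rw [tsum_eq_sum (s := Finset.range T.card)]
    · calc ∑ i ∈ Finset.range T.card, bowenSize f 𝒜 (E i) ^ s
          ≤ ∑ _i ∈ Finset.range T.card, ENNReal.ofReal (Real.exp (-(n : ℝ))) ^ s :=
            Finset.sum_le_sum fun i _ => ENNReal.rpow_le_rpow (hsize i) hs.le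
        _ = ENNReal.ofReal (T.card * Real.exp (-(n * s))) := by
            rw [Finset.sum_const, Finset.card_range, nsmul_eq_mul,
              ENNReal.ofReal_rpow_of_pos (Real.exp_pos _), ← Real.exp_mul,
              ENNReal.ofReal_mul (by positivity), ENNReal.ofReal_natCast, neg_mul]
        _ < r := by
            rw [← ENNReal.ofReal_coe_nnreal]
            exact (ENNReal.ofReal_lt_ofReal_iff hr).2 hcard
        _ < δ := hrδ
    · intro i hi
      have hi' : ¬ i < T.card := by simpa using hi
      simp only [hE, hi', dif_neg, not_false_eq_true, bowenSize_empty h𝒜]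
      exact ENNReal.zero_rpow_of_pos hs

lemma coverEntropy_mono {Y Z : Set X} (h : Y ⊆ Z) : coverEntropy f 𝒜 Y ≤ coverEntropy f 𝒜 Z := by
  refine iInf_mono fun s => iInf_mono fun hs => le_iInf fun hZ => iInf_le _ ?_
  rw [bowenMeasure_eq_zero_iff] at hZ ⊢
  intro ε hε δ hδ
  obtain ⟨E, h1, h2⟩ := hZ ε hε δ hδ
  exact ⟨E, h.trans h1, h2⟩

lemma topEntropy_mono [TopologicalSpace X] {Y Z : Set X} (h : Y ⊆ Z) :
    topEntropy f Y ≤ topEntropy f Z :=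
  iSup_mono fun _ => iSup_mono fun _ => iSup_mono fun _ => iSup_mono fun _ => coverEntropy_mono h

end Bowen

/-! ### The pressure bound for sets with large Birkhoff sums -/

section Pressure

variable {X : Type*} [MetricSpace X]

/-- A maximal separated subset of `Y` is spanning in `Y`. -/
lemma exists_separated_spanning (f : X → X) (n : ℕ) {ε : ℝ} (hε : 0 ≤ ε) (Y : Set X) (M : ℕ)
    (hM : ∀ E : Finset X, (E : Set X) ⊆ Y → IsSeparatedSet f n ε E → E.card ≤ M) :
    ∃ E : Finset X, (E : Set X) ⊆ Y ∧ IsSeparatedSet f n ε E ∧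
      Y ⊆ ⋃ x ∈ E, {y | ∀ k < n, dist (f^[k] x) (f^[k] y) ≤ ε} := by
  classical
  set S : Set ℕ := {m | ∃ E : Finset X, (E : Set X) ⊆ Y ∧ IsSeparatedSet f n ε E ∧ E.card = m}
  have hSne : S.Nonempty := ⟨0, ∅, by simp, by simp [IsSeparatedSet], rfl⟩
  have hSb : BddAbove S := ⟨M, by rintro _ ⟨E, h1, h2, rfl⟩; exact hM E h1 h2⟩
  obtain ⟨E, hEY, hE, hcard⟩ := Nat.sSup_mem hSne hSb
  refine ⟨E, hEY, hE, fun y hy => ?_⟩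
  by_contra hcon
  simp only [mem_iUnion, mem_ofPred_eq, exists_prop, not_exists, not_and, not_forall, not_le]
    at hcon
  have hyE : y ∉ E := by
    intro hyE
    obtain ⟨k, _, hk⟩ := hcon y hyE
    rw [dist_self] at hk
    exact absurd hk (not_lt.2 hε)
  have hmem : (insert y E).card ∈ S := by
    refine ⟨insert y E, ?_, ?_, rfl⟩
    · rw [Finset.coe_insert]; exact insert_subset hy hEY
    · intro u hu v hv huv
      rcases Finset.mem_insert.1 hu with rfl | hu' <;> rcases Finset.mem_insert.1 hv with rfl | hv'
      · exact absurd rfl huv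
      · obtain ⟨k, hk, h⟩ := hcon v hv'
        exact ⟨k, hk, by rwa [dist_comm]⟩
      · obtain ⟨k, hk, h⟩ := hcon u hu'
        exact ⟨k, hk, h⟩
      · exact hE u hu' v hv' huv
  have := le_csSup hSb hmem
  rw [Finset.card_insert_of_notMem hyE] at this
  omega

lemma card_mul_exp_le_partitionFunction (f : X → X) (φ : X → ℝ) {n : ℕ} {ε b : ℝ} {E : Finset X}
    (hE : IsSeparatedSet f n ε E) (hb : ∀ x ∈ E, b ≤ birkhoffSum f φ n x) :
    ENNReal.ofReal (E.card * Real.exp b) ≤ partitionFunction f φ n ε := by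
  calc ENNReal.ofReal (E.card * Real.exp b)
      = ∑ _x ∈ E, ENNReal.ofReal (Real.exp b) := by
        rw [Finset.sum_const, nsmul_eq_mul, ENNReal.ofReal_mul (by positivity),
          ENNReal.ofReal_natCast]
    _ ≤ ∑ x ∈ E, ENNReal.ofReal (Real.exp (birkhoffSum f φ n x)) :=
        Finset.sum_le_sum fun x hx =>
          ENNReal.ofReal_le_ofReal (Real.exp_le_exp.2 (hb x hx))
    _ ≤ _ := le_iSup₂_of_le E hE le_rfl

lemma eventually_partitionFunction_le {f : X → X} {φ : X → ℝ} {c : ℝ}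
    (h : pressure f φ < (c : EReal)) {ε : ℝ} (hε : 0 < ε) :
    ∀ᶠ n : ℕ in atTop, partitionFunction f φ n ε ≤ ENNReal.ofReal (Real.exp (n * c)) := by
  have h1 : limsup (fun n : ℕ => ENNReal.log (partitionFunction f φ n ε) / (n : EReal)) atTop <
      (c : EReal) := lt_of_le_of_lt (le_iSup₂_of_le (f := fun (ε : ℝ) (_ : 0 < ε) =>
        limsup (fun n : ℕ => ENNReal.log (partitionFunction f φ n ε) / (n : EReal)) atTop)
        ε hε le_rfl) h
  filter_upwards [eventually_lt_of_limsup_lt h1, eventually_gt_atTop 0] with n hn hn0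
  have hn1 : ENNReal.log (partitionFunction f φ n ε) ≤ ((n * c : ℝ) : EReal) := by
    rw [EReal.coe_mul, EReal.coe_natCast]
    exact (EReal.div_le_iff_le_mul (by exact_mod_cast hn0) (EReal.natCast_ne_top n)).1 hn.le
  have := EReal.exp_monotone hn1
  rwa [ENNReal.exp_log, EReal.exp_coe] at this

/-- If all Birkhoff averages of `φ` along points of `Y` are eventually at least `a`, then
`h_top(f, Y) ≤ P_f(φ) - a`. -/
theorem topEntropy_le_of_pressure_lt [CompactSpace X] [Nonempty X] (f : X → X) (φ : X → ℝ)
    {Y : Set X} {a : ℝ} {s : ℝ≥0} (hs : 0 < s) (hP : pressure f φ < ((s + a : ℝ) : EReal))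
    (hY : ∀ x ∈ Y, ∀ᶠ n : ℕ in atTop, n * a ≤ birkhoffSum f φ n x) :
    topEntropy f Y ≤ s := by
  refine iSup_le fun 𝒜 => iSup_le fun _ => iSup_le fun hopen => iSup_le fun hcov => ?_
  refine iInf_le_of_le s (iInf_le_of_le hs (iInf_le_of_le ?_ le_rfl))
  have hYU : Y ⊆ ⋃ N : ℕ, {x | ∀ n ≥ N, n * a ≤ birkhoffSum f φ n x} := fun x hx =>
    mem_iUnion.2 (eventually_atTop.1 (hY x hx))
  obtain ⟨c, hPc, hc⟩ := EReal.lt_iff_exists_real_btwn.1 hP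
  have hc : c < s + a := by exact_mod_cast hc
  have h𝒜 : 𝒜.Nonempty := by
    obtain ⟨U, hU, _⟩ := mem_sUnion.1 (hcov.ge (mem_univ (Classical.arbitrary X)))
    exact ⟨U, hU⟩
  obtain ⟨δ, hδ, hleb⟩ := lebesgue_number_lemma_of_metric_sUnion isCompact_univ hopen hcov.ge
  have hnull := bowenMeasure_iUnion_eq_zero (f := f) (𝒜 := 𝒜) (s := s)
    (Y := fun N : ℕ => {x | ∀ n ≥ N, n * a ≤ birkhoffSum f φ n x}) fun N => ?_
  · rw [bowenMeasure_eq_zero_iff] at hnull ⊢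
    intro ε hε η hη
    obtain ⟨E, h1, h2⟩ := hnull ε hε η hη
    exact ⟨E, hYU.trans h1, h2⟩
  refine bowenMeasure_eq_zero_of_finite_covers h𝒜 (by exact_mod_cast hs) fun η hη => ?_
  have hlim : Tendsto (fun n : ℕ => Real.exp (-(n * (s + a - c)))) atTop (𝓝 0) :=
    Real.tendsto_exp_neg_atTop_nhds_zero.comp
      (tendsto_natCast_atTop_atTop.atTop_mul_const (sub_pos.2 hc))
  filter_upwards [eventually_partitionFunction_le hPc (half_pos hδ), eventually_ge_atTop N,
    hlim.eventually_lt_const hη] with n hZ hnN hsmall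
  have hbound : ∀ E : Finset X, (E : Set X) ⊆ {x | ∀ n ≥ N, n * a ≤ birkhoffSum f φ n x} →
      IsSeparatedSet f n (δ / 2) E → (E.card : ℝ) ≤ Real.exp (n * c - n * a) := by
    intro E hEY hE
    have := (card_mul_exp_le_partitionFunction f φ hE fun x hx => hEY hx n hnN).trans hZ
    rw [ENNReal.ofReal_le_ofReal_iff (Real.exp_pos _).le] at this
    rwa [Real.exp_sub, le_div_iff₀ (Real.exp_pos _)]
  obtain ⟨E, hEY, hE, hspan⟩ := exists_separated_spanning f n (half_pos hδ).le
    {x | ∀ n ≥ N, n * a ≤ birkhoffSum f φ n x} ⌊Real.exp (n * c - n * a)⌋₊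
    fun E h1 h2 => Nat.le_floor (hbound E h1 h2)
  refine ⟨E, _, hspan, fun x _ k hk => ?_, ?_⟩
  · obtain ⟨U, hU, hsub⟩ := hleb (f^[k] x) (mem_univ _)
    refine ⟨U, hU, ?_⟩
    rintro _ ⟨y, hy, rfl⟩
    refine hsub (Metric.mem_ball.2 ?_)
    rw [dist_comm]
    exact (hy k hk).trans_lt (half_lt_self hδ)
  · calc E.card * Real.exp (-(n * s)) ≤ Real.exp (n * c - n * a) * Real.exp (-(n * s)) := by
          gcongr; exact hbound E hEY hE
      _ = Real.exp (-(n * (s + a - c))) := by rw [← Real.exp_add]; congr 1; ring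
      _ < η := hsmall

end Pressure

/-! ### Invariant measures -/

lemma mem_invariantMeasures_iff {X : Type*} [MetricSpace X] [MeasurableSpace X] [BorelSpace X]
    {f : C(X, X)} {μ : ProbabilityMeasure X} :
    μ ∈ invariantMeasures f ↔ μ.map f.continuous.measurable.aemeasurable = μ := by
  constructor
  · intro h
    exact Subtype.ext (MeasurePreserving.map_eq h)
  · intro h
    exact ⟨f.continuous.measurable, congrArg Subtype.val h⟩

section Invariant

variable {X : Type*} [MetricSpace X] [CompactSpace X] [MeasurableSpace X] [BorelSpace X]
  {f : C(X, X)}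

lemma isCompact_invariantMeasures : IsCompact (invariantMeasures f) := by
  have : invariantMeasures f =
      {μ : ProbabilityMeasure X | μ.map f.continuous.measurable.aemeasurable = μ} :=
    Set.ext fun μ => mem_invariantMeasures_iff
  rw [this]
  exact (isClosed_eq (ProbabilityMeasure.continuous_map f.continuous) continuous_id).isCompact

lemma tendsto_integral {ι : Type*} {l : Filter ι} {μs : ι → ProbabilityMeasure X}
    {μ : ProbabilityMeasure X} (h : Tendsto μs l (𝓝 μ)) (φ : C(X, ℝ)) :
    Tendsto (fun i => ∫ x, φ x ∂(μs i : Measure X)) l (𝓝 (∫ x, φ x ∂(μ : Measure X))) :=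
  ProbabilityMeasure.tendsto_iff_forall_integral_tendsto.1 h
    (BoundedContinuousFunction.mkOfCompact φ)

lemma integrable_continuousMap (μ : ProbabilityMeasure X) (φ : C(X, ℝ)) :
    Integrable φ (μ : Measure X) :=
  (BoundedContinuousFunction.mkOfCompact φ).integrable (μ : Measure X)

lemma integral_sub_le_dist (μ : ProbabilityMeasure X) (φ ψ : C(X, ℝ)) :
    |∫ x, φ x ∂(μ : Measure X) - ∫ x, ψ x ∂(μ : Measure X)| ≤ dist φ ψ := by
  rw [← integral_sub (integrable_continuousMap μ φ) (integrable_continuousMap μ ψ)]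
  have := norm_integral_le_of_norm_le_const (μ := (μ : Measure X)) (f := fun x => φ x - ψ x)
    (C := dist φ ψ) (ae_of_all _ fun x => by
      rw [← dist_eq_norm]; exact ContinuousMap.dist_apply_le_dist x)
  simpa using this

lemma integral_empiricalMeasure (φ : C(X, ℝ)) (x : X) (n : ℕ) :
    ∫ y, φ y ∂(empiricalMeasure f x n : Measure X) = birkhoffAverage ℝ f φ (n + 1) x := by
  change ∫ y, φ y ∂(((n + 1 : ℕ) : ℝ≥0∞)⁻¹ • ∑ k ∈ Finset.range (n + 1),
    Measure.dirac (f^[k] x)) = _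
  rw [integral_smul_measure, integral_finsetSum_measure]
  · have e : ((((n + 1 : ℕ) : ℝ≥0∞)⁻¹).toReal : ℝ) = ((n + 1 : ℕ) : ℝ)⁻¹ := by
      rw [ENNReal.toReal_inv, ENNReal.toReal_natCast]
    simp only [birkhoffAverage, birkhoffSum, integral_dirac, e]
  · intro k _
    exact (BoundedContinuousFunction.mkOfCompact φ).integrable (Measure.dirac (f^[k] x))

/-- Limit points of the empirical measures of a point are invariant. -/
lemma mem_invariantMeasures_of_tendsto_empiricalMeasure {x : X} {u : Filter ℕ} [u.NeBot]
    (hu : u ≤ atTop) {μ : ProbabilityMeasure X} (h : Tendsto (empiricalMeasure f x) u (𝓝 μ)) :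
    μ ∈ invariantMeasures f := by
  rw [mem_invariantMeasures_iff]
  refine tendsto_nhds_unique (ProbabilityMeasure.tendsto_iff_forall_integral_tendsto.2
    fun ψ => ?_) h
  have h1 := tendsto_integral h (ψ.toContinuousMap.comp f)
  have e1 : ∫ y, ψ y ∂(μ.map f.continuous.measurable.aemeasurable : Measure X) =
      ∫ y, ψ.toContinuousMap.comp f y ∂(μ : Measure X) :=
    integral_map f.continuous.measurable.aemeasurable
      ψ.continuous.aestronglyMeasurable
  rw [e1]
  have h2 : Tendsto (fun n : ℕ => birkhoffAverage ℝ f ψ (n + 1) (f x) -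
      birkhoffAverage ℝ f ψ (n + 1) x) atTop (𝓝 0) := by
    have hb : Bornology.IsBounded (range (ψ : X → ℝ)) := ψ.isBounded_range
    exact (tendsto_add_atTop_iff_nat 1).2
      (tendsto_birkhoffAverage_apply_sub_birkhoffAverage ℝ
        (hb.subset (range_comp_subset_range (fun n => f^[n] x) ψ)))
  have h3 := h1.sub (h2.mono_left hu)
  rw [sub_zero] at h3
  refine h3.congr fun n => ?_
  rw [integral_empiricalMeasure]
  have e2 : birkhoffAverage ℝ f (ψ.toContinuousMap.comp f) (n + 1) x =
      birkhoffAverage ℝ f ψ (n + 1) (f x) := by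
    simp only [birkhoffAverage, birkhoffSum, ContinuousMap.comp_apply]
    congr 1
    refine Finset.sum_congr rfl fun k _ => ?_
    rw [← Function.iterate_succ_apply, Function.iterate_succ_apply']
    rfl
  rw [e2, sub_sub_cancel]
  exact (integral_empiricalMeasure ψ.toContinuousMap x n).symm

lemma tendsto_integral_empiricalMeasure {φ : C(X, ℝ)} {α : ℝ} {x : X} (hx : x ∈ levelSet f φ α) :
    Tendsto (fun n => ∫ y, φ y ∂(empiricalMeasure f x n : Measure X)) atTop (𝓝 α) := by
  simp_rw [integral_empiricalMeasure]
  exact (tendsto_add_atTop_iff_nat 1).2 hx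

lemma exists_invariantMeasure_of_mem_rotationSet {φ : C(X, ℝ)} {α : ℝ}
    (hα : α ∈ rotationSet f φ) :
    ∃ μ ∈ invariantMeasures f, ∫ x, φ x ∂(μ : Measure X) = α := by
  obtain ⟨x, hx⟩ := hα
  set u : Ultrafilter ℕ := Ultrafilter.of atTop
  have hu : (u : Filter ℕ) ≤ atTop := Ultrafilter.of_le atTop
  obtain ⟨μ, -, hμ⟩ := isCompact_univ.ultrafilter_le_nhds (u.map (empiricalMeasure f x)) (by simp)
  have hμ' : Tendsto (empiricalMeasure f x) u (𝓝 μ) := hμ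
  exact ⟨μ, mem_invariantMeasures_of_tendsto_empiricalMeasure hu hμ',
    tendsto_nhds_unique (tendsto_integral hμ' φ)
      ((tendsto_integral_empiricalMeasure hx).mono_left hu)⟩

lemma genericSet_subset_levelSet (μ : ProbabilityMeasure X) (φ : C(X, ℝ)) :
    genericSet f μ ⊆ levelSet f φ (∫ x, φ x ∂(μ : Measure X)) := by
  intro x hx
  have := tendsto_integral hx φ
  simp_rw [integral_empiricalMeasure] at this
  exact (tendsto_add_atTop_iff_nat 1).1 this

/-- Invariant measures are stable under convex combinations. -/
lemma exists_invariant_convexCombination {μ ν : ProbabilityMeasure X}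
    (hμ : μ ∈ invariantMeasures f) (hν : ν ∈ invariantMeasures f) {s t : ℝ} (hs : 0 ≤ s)
    (ht : 0 ≤ t) (hst : s + t = 1) :
    ∃ ρ ∈ invariantMeasures f,
      (∀ A, (ρ : Measure X).real A = s * (μ : Measure X).real A + t * (ν : Measure X).real A) ∧
      ∀ φ : C(X, ℝ), ∫ x, φ x ∂(ρ : Measure X) =
        s * ∫ x, φ x ∂(μ : Measure X) + t * ∫ x, φ x ∂(ν : Measure X) := by
  lift s to ℝ≥0 using hs
  lift t to ℝ≥0 using ht
  have hst' : s + t = 1 := by exact_mod_cast hst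
  have hprob : IsProbabilityMeasure (s • (μ : Measure X) + t • (ν : Measure X)) := by
    constructor
    simp only [Measure.add_apply, Measure.smul_apply, measure_univ, ENNReal.smul_def,
      smul_eq_mul, mul_one]
    exact_mod_cast hst'
  refine ⟨⟨s • (μ : Measure X) + t • (ν : Measure X), hprob⟩, ⟨f.continuous.measurable, ?_⟩,
    fun A => ?_, fun φ => ?_⟩
  · have h1 := MeasurePreserving.map_eq hμ
    have h2 := MeasurePreserving.map_eq hν
    change Measure.map f (s • (μ : Measure X) + t • (ν : Measure X)) =
      s • (μ : Measure X) + t • (ν : Measure X)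
    rw [Measure.map_add _ _ f.continuous.measurable, Measure.map_smul,
      Measure.map_smul, h1, h2]
  · change (s • (μ : Measure X) + t • (ν : Measure X)).real A = _
    rw [measureReal_add_apply]
    simp
  · change ∫ x, φ x ∂(s • (μ : Measure X) + t • (ν : Measure X)) = _
    rw [integral_add_measure, integral_smul_nnreal_measure, integral_smul_nnreal_measure]
    · rfl
    · exact (integrable_continuousMap μ φ).smul_measure_nnreal
    · exact (integrable_continuousMap ν φ).smul_measure_nnreal

end Invariant

/-! ### Density of Lipschitz functions -/

/-- The algebra of Lipschitz functions on a compact metric space. -/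
def lipschitzSubalgebra (X : Type*) [MetricSpace X] [CompactSpace X] : Subalgebra ℝ C(X, ℝ) where
  carrier := {φ | ∃ K : ℝ≥0, LipschitzWith K φ}
  mul_mem' := by
    rintro φ ψ ⟨K, hK⟩ ⟨L, hL⟩
    refine ⟨‖φ‖₊ * L + ‖ψ‖₊ * K, LipschitzWith.of_dist_le_mul fun x y => ?_⟩
    have h1 := hK.dist_le_mul x y
    have h2 := hL.dist_le_mul x y
    rw [Real.dist_eq] at h1 h2
    have e : (φ * ψ) x - (φ * ψ) y = φ x * (ψ x - ψ y) + ψ y * (φ x - φ y) := by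
      simp only [ContinuousMap.mul_apply]; ring
    rw [Real.dist_eq, e]
    calc |φ x * (ψ x - ψ y) + ψ y * (φ x - φ y)|
        ≤ |φ x| * |ψ x - ψ y| + |ψ y| * |φ x - φ y| := by
          rw [← abs_mul, ← abs_mul]; exact abs_add_le _ _
      _ ≤ ‖φ‖ * (L * dist x y) + ‖ψ‖ * (K * dist x y) := by
          gcongr
          · exact φ.norm_coe_le_norm x
          · exact ψ.norm_coe_le_norm y
      _ = _ := by push_cast; ring
  add_mem' := by
    rintro φ ψ ⟨K, hK⟩ ⟨L, hL⟩
    exact ⟨K + L, hK.add hL⟩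
  algebraMap_mem' := fun r => ⟨0, LipschitzWith.const r⟩

lemma exists_lipschitz_near {X : Type*} [MetricSpace X] [CompactSpace X] (ψ : C(X, ℝ)) {δ : ℝ}
    (hδ : 0 < δ) : ∃ χ : C(X, ℝ), (∃ K : ℝ≥0, LipschitzWith K χ) ∧ dist χ ψ < δ := by
  have hsep : (lipschitzSubalgebra X).SeparatesPoints := by
    intro x y hxy
    refine ⟨fun z => dist z x, ⟨⟨fun z => dist z x, by fun_prop⟩, ⟨1, LipschitzWith.dist_left x⟩,
      rfl⟩, ?_⟩
    simpa using (dist_pos.2 hxy.symm).ne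
  obtain ⟨⟨χ, hχ⟩, h⟩ :=
    ContinuousMap.exists_mem_subalgebra_near_continuousMap_of_separatesPoints _ hsep ψ δ hδ
  exact ⟨χ, hχ, by rwa [dist_eq_norm]⟩

/-! ### The conditional variational principle -/

section Variational

variable {X : Type*} [MetricSpace X] [CompactSpace X] [MeasurableSpace X] [BorelSpace X]
  {f : C(X, X)}

omit [CompactSpace X] in
lemma metricEntropy_le_topEntropy (H3 : SaturatedProperty f) {μ : ProbabilityMeasure X}
    (hμ : μ ∈ invariantMeasures f) : metricEntropy f (μ : Measure X) ≤ topEntropy f univ := by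
  rw [← (H3 μ hμ).2]
  exact topEntropy_mono (subset_univ _)

omit [CompactSpace X] in
lemma metricEntropy_ne_top (hfin : topEntropy f univ ≠ ∞) (H3 : SaturatedProperty f)
    {μ : ProbabilityMeasure X} (hμ : μ ∈ invariantMeasures f) :
    metricEntropy f (μ : Measure X) ≠ ∞ :=
  ((metricEntropy_le_topEntropy H3 hμ).trans_lt hfin.lt_top).ne

/-- Compactness of the invariant measures together with upper semicontinuity of entropy, along a
convergent sequence of potentials. -/
lemma exists_limit_invariantMeasure (hfin : topEntropy f univ ≠ ∞)
    (H1 : EntropyUpperSemicontinuous f) (H3 : SaturatedProperty f)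
    {φs : ℕ → C(X, ℝ)} {φ : C(X, ℝ)} (hφ : Tendsto φs atTop (𝓝 φ))
    {μs : ℕ → ProbabilityMeasure X} (hμs : ∀ n, μs n ∈ invariantMeasures f)
    {α : ℝ} (hα : Tendsto (fun n => ∫ x, φs n x ∂(μs n : Measure X)) atTop (𝓝 α))
    {t : ℕ → ℝ} {τ : ℝ} (ht : Tendsto t atTop (𝓝 τ))
    (hle : ∀ n, t n ≤ (metricEntropy f (μs n : Measure X)).toReal) :
    ∃ μ ∈ invariantMeasures f, ∫ x, φ x ∂(μ : Measure X) = α ∧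
      τ ≤ (metricEntropy f (μ : Measure X)).toReal := by
  set u : Ultrafilter ℕ := Ultrafilter.of atTop
  have hu : (u : Filter ℕ) ≤ atTop := Ultrafilter.of_le atTop
  obtain ⟨μ, hμ, hlim⟩ := isCompact_invariantMeasures (f := f).ultrafilter_le_nhds (u.map μs)
    (le_principal_iff.2 (Eventually.of_forall hμs : ∀ᶠ n in (u : Filter ℕ), _))
  have hlim' : Tendsto μs u (𝓝 μ) := hlim
  refine ⟨μ, hμ, ?_, ?_⟩
  · have hdist : Tendsto (fun n => ∫ x, φs n x ∂(μs n : Measure X) -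
        ∫ x, φ x ∂(μs n : Measure X)) atTop (𝓝 0) :=
      squeeze_zero_norm (fun n => integral_sub_le_dist (μs n) (φs n) φ)
        (tendsto_iff_dist_tendsto_zero.1 hφ)
    have := (hα.sub hdist).mono_left hu
    simp only [sub_sub_cancel, sub_zero] at this
    exact tendsto_nhds_unique (tendsto_integral hlim' φ) this
  · refine le_of_forall_gt_imp_ge_of_dense fun y hy => ?_
    have hy0 : 0 < y := ENNReal.toReal_nonneg.trans_lt hy
    have hy' : metricEntropy f (μ : Measure X) < ENNReal.ofReal y :=
      (ENNReal.lt_ofReal_iff_toReal_lt (metricEntropy_ne_top hfin H3 hμ)).2 hy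
    have hev := H1 μ hμ _ hy'
    have hev' : ∀ᶠ n in (u : Filter ℕ), metricEntropy f (μs n : Measure X) < ENNReal.ofReal y :=
      (tendsto_nhdsWithin_iff.2 ⟨hlim', Eventually.of_forall hμs⟩).eventually hev
    refine le_of_tendsto (ht.mono_left hu) (hev'.mono fun n hn => ?_)
    exact (hle n).trans
      ((ENNReal.lt_ofReal_iff_toReal_lt (metricEntropy_ne_top hfin H3 (hμs n))).1 hn).le

/-- The region below the entropy of the invariant measures, fibred over the integral of `φ`. -/
def entropyHypograph (f : C(X, X)) (φ : C(X, ℝ)) : Set (ℝ × ℝ) :=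
  {p | ∃ μ ∈ invariantMeasures f, ∫ x, φ x ∂(μ : Measure X) = p.1 ∧
    p.2 ≤ (metricEntropy f (μ : Measure X)).toReal}

lemma isClosed_entropyHypograph (hfin : topEntropy f univ ≠ ∞)
    (H1 : EntropyUpperSemicontinuous f) (H3 : SaturatedProperty f) (φ : C(X, ℝ)) :
    IsClosed (entropyHypograph f φ) := by
  refine IsSeqClosed.isClosed fun p q hp hq => ?_
  choose μ hμ hint hle using hp
  refine exists_limit_invariantMeasure hfin H1 H3 (tendsto_const_nhds (x := φ)) hμ ?_
    ((continuous_snd.tendsto q).comp hq) hle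
  simp_rw [hint]
  exact (continuous_fst.tendsto q).comp hq

lemma exists_convexCombination_entropy (hfin : topEntropy f univ ≠ ∞) (H3 : SaturatedProperty f)
    {μ ν : ProbabilityMeasure X} (hμ : μ ∈ invariantMeasures f) (hν : ν ∈ invariantMeasures f)
    {s t : ℝ} (hs : 0 ≤ s) (ht : 0 ≤ t) (hst : s + t = 1) (φ : C(X, ℝ)) :
    ∃ ρ ∈ invariantMeasures f, ∫ x, φ x ∂(ρ : Measure X) =
        s * ∫ x, φ x ∂(μ : Measure X) + t * ∫ x, φ x ∂(ν : Measure X) ∧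
      s * (metricEntropy f (μ : Measure X)).toReal + t * (metricEntropy f (ν : Measure X)).toReal ≤
        (metricEntropy f (ρ : Measure X)).toReal := by
  obtain ⟨ρ, hρ, hreal, hint⟩ := exists_invariant_convexCombination hμ hν hs ht hst
  refine ⟨ρ, hρ, hint φ, ?_⟩
  have h := metricEntropy_concave hμ hν hρ hs ht hst hreal
  have hμt := metricEntropy_ne_top hfin H3 hμ
  have hνt := metricEntropy_ne_top hfin H3 hν
  have := ENNReal.toReal_mono (metricEntropy_ne_top hfin H3 hρ) h
  rwa [ENNReal.toReal_add (ENNReal.mul_ne_top ENNReal.ofReal_ne_top hμt)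
    (ENNReal.mul_ne_top ENNReal.ofReal_ne_top hνt), ENNReal.toReal_mul, ENNReal.toReal_mul,
    ENNReal.toReal_ofReal hs, ENNReal.toReal_ofReal ht] at this

lemma convex_entropyHypograph (hfin : topEntropy f univ ≠ ∞) (H3 : SaturatedProperty f)
    (φ : C(X, ℝ)) : Convex ℝ (entropyHypograph f φ) := by
  rintro ⟨a, x⟩ ⟨μ, hμ, rfl : _ = a, hx⟩ ⟨b, y⟩ ⟨ν, hν, rfl : _ = b, hy⟩ s t hs ht hst
  obtain ⟨ρ, hρ, hint, hle⟩ := exists_convexCombination_entropy hfin H3 hμ hν hs ht hst φ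
  refine ⟨ρ, hρ, by simpa using hint, le_trans ?_ hle⟩
  simp only [Prod.smul_mk, Prod.mk_add_mk, smul_eq_mul]
  gcongr

/-- Convex duality: a level above the entropies on the fibre over `α` is dominated by a line, that
is, by the free energies of a multiple `q φ`. -/
lemma exists_supporting_slope (hfin : topEntropy f univ ≠ ∞) (H1 : EntropyUpperSemicontinuous f)
    (H3 : SaturatedProperty f) {φ : C(X, ℝ)} {μ₀ : ProbabilityMeasure X}
    (hμ₀ : μ₀ ∈ invariantMeasures f) {c : ℝ}
    (hc : ∀ ν ∈ invariantMeasures f,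
      ∫ x, φ x ∂(ν : Measure X) = ∫ x, φ x ∂(μ₀ : Measure X) →
      (metricEntropy f (ν : Measure X)).toReal < c) :
    ∃ q : ℝ, ∀ ν ∈ invariantMeasures f,
      (metricEntropy f (ν : Measure X)).toReal + q * ∫ x, φ x ∂(ν : Measure X) ≤
        c + q * ∫ x, φ x ∂(μ₀ : Measure X) := by
  set α := ∫ x, φ x ∂(μ₀ : Measure X) with hα
  have hnot : (α, c) ∉ entropyHypograph f φ := by
    rintro ⟨ν, hν, h1, h2⟩
    exact absurd (hc ν hν h1) (not_lt.2 h2)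
  obtain ⟨l, u, hl, hlu⟩ := geometric_hahn_banach_closed_point
    (convex_entropyHypograph hfin H3 φ) (isClosed_entropyHypograph hfin H1 H3 φ) hnot
  have hform : ∀ x y : ℝ, l (x, y) = x * l (1, 0) + y * l (0, 1) := by
    intro x y
    have : ((x, y) : ℝ × ℝ) = x • ((1, 0) : ℝ × ℝ) + y • ((0, 1) : ℝ × ℝ) := by simp
    rw [this, map_add, map_smul, map_smul, smul_eq_mul, smul_eq_mul]
  have hsep : ∀ ν ∈ invariantMeasures f, (∫ x, φ x ∂(ν : Measure X)) * l (1, 0) +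
      (metricEntropy f (ν : Measure X)).toReal * l (0, 1) < α * l (1, 0) + c * l (0, 1) := by
    intro ν hν
    rw [← hform, ← hform]
    exact (hl _ ⟨ν, hν, rfl, le_rfl⟩).trans hlu
  have hb : 0 < l (0, 1) := by
    have h1 := hsep μ₀ hμ₀
    have h2 := hc μ₀ hμ₀ rfl
    rw [← hα] at h1
    nlinarith
  refine ⟨l (1, 0) / l (0, 1), fun ν hν => ?_⟩
  have h1 := hsep ν hν
  have h2 := div_le_div_of_nonneg_right h1.le hb.le
  have e1 : ∀ x y : ℝ, (x * l (1, 0) + y * l (0, 1)) / l (0, 1) =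
      y + l (1, 0) / l (0, 1) * x := by
    intro x y; field_simp; ring
  rwa [e1, e1] at h2

omit [CompactSpace X] in
/-- For Lipschitz potentials the existence of an equilibrium state supplies the upper half of the
variational principle for the pressure. -/
lemma pressure_le_of_lipschitz (hfin : topEntropy f univ ≠ ∞) (H2 : LipschitzUniqueEquilibrium f)
    (H3 : SaturatedProperty f) {χ : C(X, ℝ)} (hχ : ∃ K : ℝ≥0, LipschitzWith K χ) {c : ℝ}
    (hc : ∀ ν ∈ invariantMeasures f,
      (metricEntropy f (ν : Measure X)).toReal + ∫ x, χ x ∂(ν : Measure X) ≤ c) :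
    pressure f χ ≤ (c : EReal) := by
  obtain ⟨μ, ⟨hμ, hP⟩, -⟩ := H2 χ hχ
  rw [hP, ← EReal.coe_ennreal_toReal (metricEntropy_ne_top hfin H3 hμ), ← EReal.coe_add]
  exact_mod_cast hc μ hμ

omit [CompactSpace X] [BorelSpace X] in
lemma nonempty_of_lipschitzUniqueEquilibrium (H2 : LipschitzUniqueEquilibrium f) :
    (invariantMeasures f).Nonempty ∧ Nonempty X := by
  obtain ⟨μ, ⟨hμ, -⟩, -⟩ := H2 0 ⟨0, LipschitzWith.const 0⟩
  exact ⟨⟨μ, hμ⟩, μ.nonempty⟩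

omit [MeasurableSpace X] [BorelSpace X] in
lemma mul_sub_le_birkhoffSum {φ χ : C(X, ℝ)} {q δ α : ℝ} (hδ : 0 < δ)
    (hχ : dist χ (q • φ) < δ) {x : X} (hx : x ∈ levelSet f φ α) :
    ∀ᶠ n : ℕ in atTop, n * (q * α - 2 * δ) ≤ birkhoffSum f χ n x := by
  have h1 : Tendsto (fun n : ℕ => q * birkhoffAverage ℝ f φ n x) atTop (𝓝 (q * α)) :=
    Tendsto.const_mul q hx
  filter_upwards [h1.eventually_const_lt (show q * α - δ < q * α by linarith),
    eventually_gt_atTop 0] with n hn hn0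
  have hn0' : (0 : ℝ) < n := by exact_mod_cast hn0
  have h2 : ∑ k ∈ Finset.range n, (q * φ (f^[k] x) - δ) ≤ birkhoffSum f χ n x := by
    refine Finset.sum_le_sum fun k _ => ?_
    have := (ContinuousMap.dist_apply_le_dist (f := χ) (g := q • φ) (f^[k] x)).trans hχ.le
    rw [Real.dist_eq, abs_le] at this
    simp only [ContinuousMap.smul_apply, smul_eq_mul] at this
    linarith
  rw [Finset.sum_sub_distrib, ← Finset.mul_sum, Finset.sum_const, Finset.card_range,
    nsmul_eq_mul] at h2
  have h3 : ∑ k ∈ Finset.range n, φ (f^[k] x) = n * birkhoffAverage ℝ f φ n x := by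
    simp only [birkhoffAverage, birkhoffSum, smul_eq_mul]
    field_simp
  rw [h3] at h2
  nlinarith [mul_lt_mul_of_pos_left hn hn0']

/-- A linear bound on the free energies of `q φ` bounds the entropy of a level set of `φ`. The
potential `q φ` is replaced by a nearby Lipschitz one, whose pressure is controlled. -/
lemma topEntropy_levelSet_le (hfin : topEntropy f univ ≠ ∞) (H2 : LipschitzUniqueEquilibrium f)
    (H3 : SaturatedProperty f) {φ : C(X, ℝ)} {q c α : ℝ} (hc0 : 0 ≤ c)
    (hc : ∀ ν ∈ invariantMeasures f,
      (metricEntropy f (ν : Measure X)).toReal + q * ∫ x, φ x ∂(ν : Measure X) ≤ c + q * α) :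
    topEntropy f (levelSet f φ α) ≤ ENNReal.ofReal c := by
  have := (nonempty_of_lipschitzUniqueEquilibrium H2).2
  refine ENNReal.le_of_forall_pos_le_add fun ε hε _ => ?_
  have hδ : (0 : ℝ) < ε / 4 := by positivity
  obtain ⟨χ, hlip, hχ⟩ := exists_lipschitz_near (q • φ) hδ
  have hP : pressure f χ ≤ ((c + q * α + ε / 4 : ℝ) : EReal) := by
    refine pressure_le_of_lipschitz hfin H2 H3 hlip fun ν hν => ?_
    have h1 := (abs_le.1 ((integral_sub_le_dist ν χ (q • φ)).trans hχ.le)).2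
    have h2 : ∫ x, (q • φ) x ∂(ν : Measure X) = q * ∫ x, φ x ∂(ν : Measure X) :=
      integral_const_mul q _
    rw [h2] at h1
    linarith [hc ν hν]
  have hs : 0 < c.toNNReal + ε := add_pos_of_nonneg_of_pos zero_le hε
  have := topEntropy_le_of_pressure_lt f χ (Y := levelSet f φ α) (a := q * α - 2 * (ε / 4))
    (s := c.toNNReal + ε) hs (hP.trans_lt ?_) fun x hx => mul_sub_le_birkhoffSum hδ hχ hx
  · simpa [ENNReal.ofReal] using this
  · rw [EReal.coe_lt_coe_iff, NNReal.coe_add, Real.coe_toNNReal c hc0]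
    linarith

lemma integral_mem_rotationSet (H3 : SaturatedProperty f) {μ : ProbabilityMeasure X}
    (hμ : μ ∈ invariantMeasures f) (φ : C(X, ℝ)) :
    ∫ x, φ x ∂(μ : Measure X) ∈ rotationSet f φ :=
  (H3 μ hμ).1.mono (genericSet_subset_levelSet μ φ)

omit [CompactSpace X] [MeasurableSpace X] [BorelSpace X] in
lemma topEntropy_levelSet_ne_top (hfin : topEntropy f univ ≠ ∞) (φ : C(X, ℝ)) (α : ℝ) :
    topEntropy f (levelSet f φ α) ≠ ∞ :=
  ((topEntropy_mono (subset_univ _)).trans_lt hfin.lt_top).ne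

lemma metricEntropy_le_entropySpectrum (hfin : topEntropy f univ ≠ ∞) (H3 : SaturatedProperty f)
    {μ : ProbabilityMeasure X} (hμ : μ ∈ invariantMeasures f) (φ : C(X, ℝ)) :
    (metricEntropy f (μ : Measure X)).toReal ≤
      entropySpectrum f φ (∫ x, φ x ∂(μ : Measure X)) := by
  refine ENNReal.toReal_mono (topEntropy_levelSet_ne_top hfin φ _) ?_
  rw [← (H3 μ hμ).2]
  exact topEntropy_mono (genericSet_subset_levelSet μ φ)

/-- The conditional variational principle, with the supremum attained: the entropy of a level set
is the largest entropy of an invariant measure integrating `φ` to the given value. -/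
theorem exists_entropySpectrum_eq_metricEntropy (hfin : topEntropy f univ ≠ ∞)
    (H1 : EntropyUpperSemicontinuous f) (H2 : LipschitzUniqueEquilibrium f)
    (H3 : SaturatedProperty f) {φ : C(X, ℝ)} {α : ℝ} (hα : α ∈ rotationSet f φ) :
    ∃ μ ∈ invariantMeasures f, ∫ x, φ x ∂(μ : Measure X) = α ∧
      entropySpectrum f φ α = (metricEntropy f (μ : Measure X)).toReal := by
  set K : Set (ProbabilityMeasure X) :=
    invariantMeasures f ∩ {μ | ∫ x, φ x ∂(μ : Measure X) = α} with hK
  have hKc : IsCompact K := isCompact_invariantMeasures.inter_right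
    (isClosed_eq (continuous_iff_continuousAt.2 fun μ => tendsto_integral tendsto_id φ)
      continuous_const)
  have hKne : K.Nonempty := by
    obtain ⟨μ, hμ, h⟩ := exists_invariantMeasure_of_mem_rotationSet hα
    exact ⟨μ, hμ, h⟩
  obtain ⟨μ, ⟨hμ, hint⟩, hmax⟩ := UpperSemicontinuousOn.exists_isMaxOn hKne hKc
    (fun ν hν => (H1 ν hν.1).mono inter_subset_left)
  have hint : ∫ x, φ x ∂(μ : Measure X) = α := hint
  refine ⟨μ, hμ, hint, le_antisymm ?_ ?_⟩
  · refine le_of_forall_gt_imp_ge_of_dense fun c hc => ?_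
    have hc0 : 0 ≤ c := ENNReal.toReal_nonneg.trans hc.le
    obtain ⟨q, hq⟩ := exists_supporting_slope hfin H1 H3 (φ := φ) hμ (c := c) fun ν hν hνα =>
      (ENNReal.toReal_mono (metricEntropy_ne_top hfin H3 hμ)
        (hmax ⟨hν, hνα.trans hint⟩)).trans_lt hc
    rw [hint] at hq
    exact ENNReal.toReal_le_of_le_ofReal hc0 (topEntropy_levelSet_le hfin H2 H3 hc0 hq)
  · have := metricEntropy_le_entropySpectrum hfin H3 hμ φ
    rwa [hint] at this

end Variational

/-! ### Nonnegative concave functions on an interval -/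

/-- A nonnegative concave function on a compact interval decays at most linearly away from a point,
endpoints included. -/
lemma exists_lower_bound_of_concaveOn_Icc {a b : ℝ} {g : ℝ → ℝ} (hg : ConcaveOn ℝ (Icc a b) g)
    (h0 : ∀ β ∈ Icc a b, 0 ≤ g β) {α : ℝ} (hα : α ∈ Icc a b) :
    ∃ K : ℝ, ∀ β ∈ Icc a b, g α * (1 - K * |β - α|) ≤ g β := by
  have chord : ∀ e ∈ Icc a b, ∀ t : ℝ, 0 ≤ t → t ≤ 1 → (1 - t) * g α ≤ g ((1 - t) * α + t * e) := by
    intro e he t ht ht1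
    have := hg.2 hα he (sub_nonneg.2 ht1) ht (by ring)
    simp only [smul_eq_mul] at this
    nlinarith [h0 e he, mul_nonneg ht (h0 e he)]
  have hab : a ≤ b := hα.1.trans hα.2
  -- when `α` is an endpoint one of the two inverses is `0⁻¹ = 0` and is never needed
  have h1 : 0 ≤ (b - α)⁻¹ := inv_nonneg.2 (sub_nonneg.2 hα.2)
  have h2 : 0 ≤ (α - a)⁻¹ := inv_nonneg.2 (sub_nonneg.2 hα.1)
  refine ⟨(b - α)⁻¹ + (α - a)⁻¹, fun β hβ => ?_⟩
  have hgα := h0 α hα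
  rcases lt_trichotomy β α with h | rfl | h
  · have hpos : 0 < α - a := by linarith [hβ.1]
    have key := chord a ⟨le_rfl, hab⟩ ((α - β) * (α - a)⁻¹)
      (mul_nonneg (by linarith) h2) (by rw [← div_eq_mul_inv, div_le_one hpos]; linarith [hβ.1])
    have e : (1 - (α - β) * (α - a)⁻¹) * α + (α - β) * (α - a)⁻¹ * a = β := by
      field_simp; ring
    rw [e] at key
    rw [abs_of_neg (by linarith)]
    refine le_trans ?_ key
    rw [mul_comm]
    refine mul_le_mul_of_nonneg_right ?_ hgα
    nlinarith [mul_nonneg h1 (sub_nonneg.2 h.le)]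
  · simp
  · have hpos : 0 < b - α := by linarith [hβ.2]
    have key := chord b ⟨hab, le_rfl⟩ ((β - α) * (b - α)⁻¹)
      (mul_nonneg (by linarith) h1) (by rw [← div_eq_mul_inv, div_le_one hpos]; linarith [hβ.2])
    have e : (1 - (β - α) * (b - α)⁻¹) * α + (β - α) * (b - α)⁻¹ * b = β := by
      field_simp; ring
    rw [e] at key
    rw [abs_of_pos (by linarith)]
    refine le_trans ?_ key
    rw [mul_comm]
    refine mul_le_mul_of_nonneg_right ?_ hgα
    nlinarith [mul_nonneg h2 (sub_nonneg.2 h.le)]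

/-! ### Shape of the spectrum -/

section Shape

variable {X : Type*} [MetricSpace X] [CompactSpace X] [MeasurableSpace X] [BorelSpace X]
  {f : C(X, X)}

lemma rotationSet_eq_image (H3 : SaturatedProperty f) (φ : C(X, ℝ)) :
    rotationSet f φ = (fun μ : ProbabilityMeasure X => ∫ x, φ x ∂(μ : Measure X)) ''
      invariantMeasures f := by
  ext α
  constructor
  · intro hα
    exact exists_invariantMeasure_of_mem_rotationSet hα
  · rintro ⟨μ, hμ, rfl⟩
    exact integral_mem_rotationSet H3 hμ φ

lemma rotationSet_nonempty (H2 : LipschitzUniqueEquilibrium f) (H3 : SaturatedProperty f)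
    (φ : C(X, ℝ)) : (rotationSet f φ).Nonempty := by
  rw [rotationSet_eq_image H3]
  exact (nonempty_of_lipschitzUniqueEquilibrium H2).1.image _

lemma isCompact_rotationSet (H3 : SaturatedProperty f) (φ : C(X, ℝ)) :
    IsCompact (rotationSet f φ) := by
  rw [rotationSet_eq_image H3]
  exact isCompact_invariantMeasures.image
    (continuous_iff_continuousAt.2 fun μ => tendsto_integral tendsto_id φ)

lemma mem_entropyHypograph_iff (hfin : topEntropy f univ ≠ ∞)
    (H1 : EntropyUpperSemicontinuous f) (H2 : LipschitzUniqueEquilibrium f)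
    (H3 : SaturatedProperty f) {φ : C(X, ℝ)} {α c : ℝ} :
    (α, c) ∈ entropyHypograph f φ ↔ α ∈ rotationSet f φ ∧ c ≤ entropySpectrum f φ α := by
  constructor
  · rintro ⟨μ, hμ, rfl : _ = α, h⟩
    exact ⟨integral_mem_rotationSet H3 hμ φ,
      h.trans (metricEntropy_le_entropySpectrum hfin H3 hμ φ)⟩
  · rintro ⟨hα, hc⟩
    obtain ⟨μ, hμ, h1, h2⟩ := exists_entropySpectrum_eq_metricEntropy hfin H1 H2 H3 hα
    exact ⟨μ, hμ, h1, h2 ▸ hc⟩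

lemma concaveOn_entropySpectrum (hfin : topEntropy f univ ≠ ∞)
    (H1 : EntropyUpperSemicontinuous f) (H2 : LipschitzUniqueEquilibrium f)
    (H3 : SaturatedProperty f) (φ : C(X, ℝ)) :
    ConcaveOn ℝ (rotationSet f φ) (entropySpectrum f φ) := by
  have key : ∀ α ∈ rotationSet f φ, ∀ β ∈ rotationSet f φ, ∀ s t : ℝ, 0 ≤ s → 0 ≤ t →
      s + t = 1 → s • α + t • β ∈ rotationSet f φ ∧
        s • entropySpectrum f φ α + t • entropySpectrum f φ β ≤
          entropySpectrum f φ (s • α + t • β) := by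
    intro α hα β hβ s t hs ht hst
    have h := convex_entropyHypograph hfin H3 φ
      ((mem_entropyHypograph_iff hfin H1 H2 H3).2 ⟨hα, le_rfl⟩)
      ((mem_entropyHypograph_iff hfin H1 H2 H3).2 ⟨hβ, le_rfl⟩) hs ht hst
    exact (mem_entropyHypograph_iff hfin H1 H2 H3).1 h
  exact ⟨fun α hα β hβ s t hs ht hst => (key α hα β hβ s t hs ht hst).1,
    fun α hα β hβ s t hs ht hst => (key α hα β hβ s t hs ht hst).2⟩

lemma exists_rotationSet_eq_Icc (hfin : topEntropy f univ ≠ ∞)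
    (H1 : EntropyUpperSemicontinuous f) (H2 : LipschitzUniqueEquilibrium f)
    (H3 : SaturatedProperty f) (φ : C(X, ℝ)) :
    ∃ a b : ℝ, a ≤ b ∧ rotationSet f φ = Icc a b := by
  have hne := rotationSet_nonempty H2 H3 φ
  have hIcc := eq_Icc_of_connected_compact
    ⟨hne, (concaveOn_entropySpectrum hfin H1 H2 H3 φ).1.isPreconnected⟩
    (isCompact_rotationSet H3 φ)
  exact ⟨_, _, nonempty_Icc.1 (hIcc ▸ hne), hIcc⟩

omit [CompactSpace X] [MeasurableSpace X] [BorelSpace X] in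
lemma entropySpectrum_nonneg (φ : C(X, ℝ)) (α : ℝ) : 0 ≤ entropySpectrum f φ α :=
  ENNReal.toReal_nonneg

/-- Upper semicontinuity comes from the closed hypograph, lower semicontinuity from concavity. -/
lemma continuousOn_entropySpectrum (hfin : topEntropy f univ ≠ ∞)
    (H1 : EntropyUpperSemicontinuous f) (H2 : LipschitzUniqueEquilibrium f)
    (H3 : SaturatedProperty f) (φ : C(X, ℝ)) :
    ContinuousOn (entropySpectrum f φ) (rotationSet f φ) := by
  intro α hα
  refine tendsto_order.2 ⟨fun c hc => ?_, fun c hc => ?_⟩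
  · obtain ⟨a, b, -, hR⟩ := exists_rotationSet_eq_Icc hfin H1 H2 H3 φ
    obtain ⟨K, hK⟩ := exists_lower_bound_of_concaveOn_Icc
      (hR ▸ concaveOn_entropySpectrum hfin H1 H2 H3 φ)
      (fun β _ => entropySpectrum_nonneg φ β) (hR ▸ hα)
    have hlim : Tendsto (fun β => entropySpectrum f φ α * (1 - K * |β - α|)) (𝓝 α)
        (𝓝 (entropySpectrum f φ α)) := by
      have : Continuous fun β => entropySpectrum f φ α * (1 - K * |β - α|) := by fun_prop
      simpa using this.tendsto α
    filter_upwards [nhdsWithin_le_nhds (hlim.eventually_const_lt hc), self_mem_nhdsWithin]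
      with β hβ hβR
    exact hβ.trans_le (hK β (hR ▸ hβR))
  · have hcl : IsClosed {β : ℝ | (β, c) ∈ entropyHypograph f φ} :=
      (isClosed_entropyHypograph hfin H1 H3 φ).preimage (by fun_prop)
    have hα' : α ∈ {β : ℝ | (β, c) ∈ entropyHypograph f φ}ᶜ := fun h =>
      absurd ((mem_entropyHypograph_iff hfin H1 H2 H3).1 h).2 (not_le.2 hc)
    filter_upwards [nhdsWithin_le_nhds (hcl.isOpen_compl.mem_nhds hα'), self_mem_nhdsWithin]
      with β hβ hβR
    by_contra hcon
    exact hβ ((mem_entropyHypograph_iff hfin H1 H2 H3).2 ⟨hβR, not_lt.1 hcon⟩)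

lemma continuous_euclideanPair : Continuous fun p : ℝ × ℝ => !₂[p.1, p.2] := by
  refine (PiLp.continuous_toLp 2 _).comp (continuous_pi fun i => ?_)
  fin_cases i
  · exact continuous_fst
  · exact continuous_snd

lemma isCompact_spectrumGraph (hfin : topEntropy f univ ≠ ∞)
    (H1 : EntropyUpperSemicontinuous f) (H2 : LipschitzUniqueEquilibrium f)
    (H3 : SaturatedProperty f) (φ : C(X, ℝ)) :
    IsCompact (spectrumGraph (rotationSet f φ) (entropySpectrum f φ)) :=
  (isCompact_rotationSet H3 φ).image_of_continuousOn
    (continuous_euclideanPair.comp_continuousOn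
      (continuousOn_id.prodMk (continuousOn_entropySpectrum hfin H1 H2 H3 φ)))

/-- The equilibrium state of the zero potential has entropy at least `h_top(f)` and is the only
invariant measure with that property; its integral is where the spectrum peaks. -/
lemma exists_unique_max_entropySpectrum (hfin : topEntropy f univ ≠ ∞)
    (H1 : EntropyUpperSemicontinuous f) (H2 : LipschitzUniqueEquilibrium f)
    (H3 : SaturatedProperty f) (hpos : 0 < topEntropy f univ) (φ : C(X, ℝ)) :
    ∃ α ∈ rotationSet f φ, 0 < entropySpectrum f φ α ∧
      ∀ β ∈ rotationSet f φ, β ≠ α → entropySpectrum f φ β < entropySpectrum f φ α := by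
  have := (nonempty_of_lipschitzUniqueEquilibrium H2).2
  obtain ⟨μ, ⟨hμ, hP⟩, huniq⟩ := H2 0 ⟨0, LipschitzWith.const 0⟩
  have hP0 : pressure f (0 : C(X, ℝ)) = (metricEntropy f (μ : Measure X) : EReal) := by
    simpa using hP
  have htop : topEntropy f univ ≤ metricEntropy f (μ : Measure X) := by
    refine le_of_forall_gt_imp_ge_of_dense fun s hs => ?_
    rcases eq_or_ne s ∞ with rfl | hs'
    · exact le_top
    lift s to ℝ≥0 using hs'
    refine topEntropy_le_of_pressure_lt f (0 : C(X, ℝ)) (a := 0)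
      (by exact_mod_cast zero_le.trans_lt hs) ?_ fun x _ => Eventually.of_forall fun n => ?_
    · rw [hP0, add_zero, ← EReal.coe_nnreal_eq_coe_real]
      exact EReal.coe_ennreal_lt_coe_ennreal_iff.2 hs
    · simp [birkhoffSum]
  have hmax : ∀ ν ∈ invariantMeasures f,
      metricEntropy f (ν : Measure X) ≤ metricEntropy f (μ : Measure X) := fun ν hν =>
    (metricEntropy_le_topEntropy H3 hν).trans htop
  have hle := metricEntropy_le_entropySpectrum hfin H3 hμ φ
  refine ⟨_, integral_mem_rotationSet H3 hμ φ, lt_of_lt_of_le ?_ hle, fun β hβ hne => ?_⟩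
  · exact ENNReal.toReal_pos (hpos.trans_le htop).ne' (metricEntropy_ne_top hfin H3 hμ)
  · obtain ⟨ν, hν, hint, hE⟩ := exists_entropySpectrum_eq_metricEntropy hfin H1 H2 H3 hβ
    refine lt_of_lt_of_le ?_ hle
    rw [hE]
    refine ENNReal.toReal_strict_mono (metricEntropy_ne_top hfin H3 hμ)
      (lt_of_le_of_ne (hmax ν hν) fun heq => hne ?_)
    have : ν = μ := huniq ν ⟨hν, by rw [hP0, heq]; simp⟩
    rw [← hint, this]

end Shape

/-! ### Lower semicontinuity of the spectrum map -/

/-- On a compact set, pointwise convergence of the distances to moving sets is uniform. -/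
lemma tendsto_excess_of_isCompact {P : Type*} [PseudoMetricSpace P] {A : Set P} (hA : IsCompact A)
    {B : ℕ → Set P} (h : ∀ a ∈ A, Tendsto (fun n => Metric.infEDist a (B n)) atTop (𝓝 0)) :
    Tendsto (fun n => excess A (B n)) atTop (𝓝 0) := by
  rw [ENNReal.tendsto_nhds_zero]
  intro ε hε
  obtain ⟨r, hr0, hrε⟩ := ENNReal.lt_iff_exists_nnreal_btwn.1 (ENNReal.half_pos hε.ne')
  have hr : (0 : ℝ) < r := by exact_mod_cast hr0
  obtain ⟨T, hTA, hTfin, hcov⟩ := hA.finite_cover_balls hr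
  have hev : ∀ᶠ n in atTop, ∀ a ∈ T, Metric.infEDist a (B n) ≤ ε / 2 :=
    (hTfin.eventually_all).2 fun a ha =>
      ENNReal.tendsto_nhds_zero.1 (h a (hTA ha)) _ (ENNReal.half_pos hε.ne')
  filter_upwards [hev] with n hn
  refine iSup₂_le fun p hp => ?_
  obtain ⟨a, ha, hpa⟩ := mem_iUnion₂.1 (hcov hp)
  have hedist : edist p a ≤ ε / 2 := by
    refine le_trans ?_ hrε.le
    rw [edist_nndist]
    exact_mod_cast (Metric.mem_ball.1 hpa).le
  calc Metric.infEDist p (B n) ≤ edist p a + Metric.infEDist a (B n) :=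
        Metric.infEDist_le_edist_add_infEDist
    _ ≤ ε / 2 + ε / 2 := add_le_add hedist (hn a ha)
    _ = ε := ENNReal.add_halves ε

section Semicontinuity

variable {X : Type*} [MetricSpace X] [CompactSpace X] [MeasurableSpace X] [BorelSpace X]
  {f : C(X, X)}

/-- Upper semicontinuity of the spectrum jointly in the potential and the level. -/
lemma le_entropySpectrum_of_tendsto (hfin : topEntropy f univ ≠ ∞)
    (H1 : EntropyUpperSemicontinuous f) (H2 : LipschitzUniqueEquilibrium f)
    (H3 : SaturatedProperty f) {φs : ℕ → C(X, ℝ)} {φ : C(X, ℝ)} (hφ : Tendsto φs atTop (𝓝 φ))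
    {αs : ℕ → ℝ} {α c : ℝ} (hmem : ∀ n, αs n ∈ rotationSet f (φs n))
    (hα : Tendsto αs atTop (𝓝 α)) (hc : ∀ n, c ≤ entropySpectrum f (φs n) (αs n)) :
    c ≤ entropySpectrum f φ α := by
  choose μ hμ hint hE using fun n =>
    exists_entropySpectrum_eq_metricEntropy hfin H1 H2 H3 (hmem n)
  obtain ⟨ν, hν, h1, h2⟩ := exists_limit_invariantMeasure hfin H1 H3 hφ hμ
    (by simpa only [hint] using hα) (tendsto_const_nhds (x := c)) fun n => hE n ▸ hc n
  rw [← h1]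
  exact h2.trans (metricEntropy_le_entropySpectrum hfin H3 hν φ)

/-- A maximizing measure `μ` for the level `α` of `φ` gives the levels `∫ φₙ dμ` of `φₙ`, whose
points on the graphs converge to the one over `α`. -/
lemma tendsto_infEDist_spectrumGraph (hfin : topEntropy f univ ≠ ∞)
    (H1 : EntropyUpperSemicontinuous f) (H2 : LipschitzUniqueEquilibrium f)
    (H3 : SaturatedProperty f) {φs : ℕ → C(X, ℝ)} {φ : C(X, ℝ)} (hφ : Tendsto φs atTop (𝓝 φ))
    {α : ℝ} (hα : α ∈ rotationSet f φ) :
    Tendsto (fun n => Metric.infEDist !₂[α, entropySpectrum f φ α]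
      (spectrumGraph (rotationSet f (φs n)) (entropySpectrum f (φs n)))) atTop (𝓝 0) := by
  obtain ⟨μ, hμ, hint, hE⟩ := exists_entropySpectrum_eq_metricEntropy hfin H1 H2 H3 hα
  set αs : ℕ → ℝ := fun n => ∫ x, φs n x ∂(μ : Measure X) with hαs
  have hmem : ∀ n, αs n ∈ rotationSet f (φs n) := fun n => integral_mem_rotationSet H3 hμ _
  have hαlim : Tendsto αs atTop (𝓝 α) := by
    rw [tendsto_iff_dist_tendsto_zero]
    refine squeeze_zero (fun _ => dist_nonneg) (fun n => ?_) (tendsto_iff_dist_tendsto_zero.1 hφ)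
    rw [← hint]
    exact integral_sub_le_dist μ (φs n) φ
  have hElim : Tendsto (fun n => entropySpectrum f (φs n) (αs n)) atTop
      (𝓝 (entropySpectrum f φ α)) := by
    refine tendsto_order.2 ⟨fun c hc => Eventually.of_forall fun n => ?_, fun c hc => ?_⟩
    · rw [hE] at hc
      exact hc.trans_le (metricEntropy_le_entropySpectrum hfin H3 hμ (φs n))
    · by_contra hcon
      obtain ⟨k, hk, hck⟩ := extraction_of_frequently_atTop (not_eventually.1 hcon)
      exact absurd (le_entropySpectrum_of_tendsto hfin H1 H2 H3 (hφ.comp hk.tendsto_atTop)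
        (fun n => hmem (k n)) (hαlim.comp hk.tendsto_atTop) fun n => not_lt.1 (hck n))
        (not_le.2 hc)
  have hpt : Tendsto (fun n => !₂[αs n, entropySpectrum f (φs n) (αs n)]) atTop
      (𝓝 !₂[α, entropySpectrum f φ α]) :=
    (continuous_euclideanPair.tendsto (α, entropySpectrum f φ α)).comp
      (hαlim.prodMk_nhds hElim)
  refine tendsto_of_tendsto_of_tendsto_of_le_of_le tendsto_const_nhds
    (tendsto_iff_edist_tendsto_0.1 hpt) (fun _ => zero_le) fun n => ?_
  rw [edist_comm]
  exact Metric.infEDist_le_edist_of_mem ⟨αs n, hmem n, rfl⟩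

end Semicontinuity

end MultifractalSpectrum

theorem theoremC {X : Type*} [MetricSpace X] [CompactSpace X] [MeasurableSpace X] [BorelSpace X]
    (f : C(X, X))
    (hfin : topEntropy f univ ≠ ∞)
    (H1 : EntropyUpperSemicontinuous f)
    (H2 : LipschitzUniqueEquilibrium f)
    (H3 : SaturatedProperty f) :
    (∀ φ : C(X, ℝ), ∀ α ∈ rotationSet f φ, topEntropy f (levelSet f φ α) ≠ ∞) ∧
    (0 < topEntropy f univ →
      ∀ φ : C(X, ℝ), MemCms (rotationSet f φ) (entropySpectrum f φ)) ∧
    (∀ φ : C(X, ℝ),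
      (spectrumGraph (rotationSet f φ) (entropySpectrum f φ)).Nonempty ∧
      IsCompact (spectrumGraph (rotationSet f φ) (entropySpectrum f φ))) ∧
    ∀ φ : C(X, ℝ),
      LowerSemicontinuousSetMapAt
        (fun ψ : C(X, ℝ) => spectrumGraph (rotationSet f ψ) (entropySpectrum f ψ)) φ := by
  refine ⟨fun φ α _ => topEntropy_levelSet_ne_top hfin φ α, fun hpos φ => ?_, fun φ => ?_,
    fun φ φs hφ => ?_⟩
  · exact ⟨exists_rotationSet_eq_Icc hfin H1 H2 H3 φ, fun α _ => entropySpectrum_nonneg φ α,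
      continuousOn_entropySpectrum hfin H1 H2 H3 φ, concaveOn_entropySpectrum hfin H1 H2 H3 φ,
      exists_unique_max_entropySpectrum hfin H1 H2 H3 hpos φ⟩
  · exact ⟨(rotationSet_nonempty H2 H3 φ).image _, isCompact_spectrumGraph hfin H1 H2 H3 φ⟩
  · refine tendsto_excess_of_isCompact (isCompact_spectrumGraph hfin H1 H2 H3 φ) ?_
    rintro _ ⟨α, hα, rfl⟩
    exact tendsto_infEDist_spectrumGraph hfin H1 H2 H3 hφ hα
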